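/- Let $\lambda=\tfrac12(-1+\sqrt{-11})$ (with $\sqrt{-11}=i\sqrt{11}$), let $E_\lambda=\mathbf C/\mathbf Z[\lambda]$, and let $\mathbb G=\mathrm{PSL}(2,\mathbf F_{11})$. Let $\xi$ be the irreducible $5$-dimensional complex representation of $\mathbb G$ for which, in a suitable basis, with $\zeta=e^{2i\pi/11}$, the class of $\begin{pmatrix}5&0\\0&9\end{pmatrix}$ acts by the cyclic permutation $e_1\mapsto e_2\mapsto e_3\mapsto e_4\mapsto e_5\mapsto e_1$ and the class of $\begin{pmatrix}1&1\\0&1\end{pmatrix}$ acts by $\mathrm{diag}(\zeta,\zeta^4,\zeta^5,\zeta^9,\zeta^3)$. Let $H'$ be the Hermitian form on $\mathbf Z[\lambda]^5$ with Gram matrix $$\begin{pmatrix}3&1-\bar\lambda&-\lambda&1&-\bar\lambda\\ 1-\lambda&3&-1&-\lambda&1\\ -\bar\lambda&-1&3&\lambda&-1+\lambda\\ 1&-\bar\lambda&\bar\lambda&3&1-\bar\lambda\\ -\lambda&1&-1+\bar\lambda&1-\lambda&3\end{pmatrix},$$ and let $H$ be the Hermitian form on $\bigwedge^2\mathbf Z[\lambda]^5=\mathbf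 Z[\lambda]^{10}$ (with basis $e_i\wedge e_j$, $i<j$, in lexicographic order) defined by $$H(x_1\wedge x_2,x_3\wedge x_4)=H'(x_1,x_3)H'(x_2,x_4)-H'(x_1,x_4)H'(x_2,x_3).$$ Then: 1. $H'$ is positive definite and unimodular, and it has an automorphism of order $11$. 2. $H$ is positive definite and unimodular. If $M$ is its Gram matrix, the form $(v,w)\mapsto(\operatorname{Im}\lambda)^{-1}\,\overline{w}^{T}Mv$ on $\mathbf C^{10}$ defines a principal polarization $\theta$ on $E_\lambda^{10}$: it is Hermitian and positive definite, its imaginary part takes integral values on $\mathbf Z[\lambda]^{10}$, and the induced homomorphism from $E_\lambda^{10}$ to its dual is an isomorphism. 3. There is a faithful action $\mathbb G\hookrightarrow\mathrm{Aut}(E_\lambda^{10},\theta)$ by automorphisms preserving $\theta$ whose analytic representation (the action on the tangent space at the origin) is irreducible and isomorphic to $\bigwedge^2\xi$. -/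

import Mathlib

open scoped Matrix ComplexOrder Topology

/-! ## Complex tori, polarizations and their automorphisms -/

/-- A complex torus with underlying group `X` and tangent space at the origin `V`, given by its
universal covering homomorphism `V → X`, whose kernel is a lattice in `V`. -/
structure ComplexTorus (V X : Type*) [NormedAddCommGroup V] [NormedSpace ℂ V]
    [FiniteDimensional ℂ V] [AddCommGroup X] where
  /-- the universal covering -/
  proj : V →+ X
  surjective : Function.Surjective proj
  discrete : DiscreteTopology proj.ker
  full : Submodule.span ℝ (proj.ker : Set V) = ⊤

namespace ComplexTorus

variable {V X : Type*} [NormedAddCommGroup V] [NormedSpace ℂ V] [FiniteDimensional ℂ V]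
  [AddCommGroup X]

/-- The lattice of periods. -/
def lattice (T : ComplexTorus V X) : AddSubgroup V := T.proj.ker

/-- A self-map of a complex torus is holomorphic if, near every point, it lifts through the
universal covering to a holomorphic map. -/
def IsHolomorphic (T : ComplexTorus V X) (u : X → X) : Prop :=
  ∀ v : V, ∃ F : V → V, AnalyticAt ℂ F v ∧ ∀ᶠ w in 𝓝 v, u (T.proj w) = T.proj (F w)

/-- `A` is the tangent map at the origin of `u` (a map fixing the origin): it is the differential
at `0` of a local lift of `u` fixing `0`. -/
def HasTangentMap (T : ComplexTorus V X) (u : X → X) (A : V →L[ℂ] V) : Prop :=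
  ∃ F : V → V, F 0 = 0 ∧ HasFDerivAt F A 0 ∧ ∀ᶠ w in 𝓝 (0 : V), u (T.proj w) = T.proj (F w)

/-- A polarization, given by its first Chern class: a positive definite Hermitian form on the
tangent space (linear in the first variable, antilinear in the second one) whose imaginary part
takes integral values on the lattice. -/
structure IsPolarization (T : ComplexTorus V X) (H : V →ₗ[ℂ] V →ₗ⋆[ℂ] ℂ) : Prop where
  hermitian : ∀ v w, H w v = star (H v w)
  pos : ∀ v, v ≠ 0 → 0 < (H v v).re
  integral : ∀ v ∈ T.lattice, ∀ w ∈ T.lattice, ∃ n : ℤ, (H v w).im = n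

/-- The lattice of the dual torus: the antilinear forms whose imaginary part takes integral values
on the lattice. -/
def dualLattice (T : ComplexTorus V X) : AddSubgroup (V →ₗ⋆[ℂ] ℂ) where
  carrier := {l | ∀ v ∈ T.lattice, ∃ n : ℤ, (l v).im = n}
  zero_mem' := fun _ _ => ⟨0, by simp⟩
  add_mem' := by
    intro a b ha hb v hv
    obtain ⟨m, hm⟩ := ha v hv
    obtain ⟨n, hn⟩ := hb v hv
    exact ⟨m + n, by simp [hm, hn]⟩
  neg_mem' := by
    intro a ha v hv
    obtain ⟨m, hm⟩ := ha v hv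
    exact ⟨-m, by simp [hm]⟩

/-- The dual torus `Pic⁰`: antilinear forms modulo the dual lattice. -/
abbrev Dual (T : ComplexTorus V X) : Type _ := (V →ₗ⋆[ℂ] ℂ) ⧸ T.dualLattice

/-- A polarization is principal if the homomorphism from the torus to its dual induced by
`v ↦ H(v, ·)` is an isomorphism. -/
def IsPrincipalPolarization (T : ComplexTorus V X) (H : V →ₗ[ℂ] V →ₗ⋆[ℂ] ℂ) : Prop :=
  T.IsPolarization H ∧
    ∃ φ : X ≃+ T.Dual, ∀ v : V, φ (T.proj v) = QuotientAddGroup.mk (H v)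

/-- Tangent maps at the origin are unique. -/
theorem HasTangentMap.unique {T : ComplexTorus V X} {u : X → X} {A B : V →L[ℂ] V}
    (hA : T.HasTangentMap u A) (hB : T.HasTangentMap u B) : A = B := by
  obtain ⟨F, F0, hF, hFu⟩ := hA
  obtain ⟨G, G0, hG, hGu⟩ := hB
  have hd := T.discrete
  have hc : Filter.Tendsto (F - G) (𝓝 0) (𝓝 0) := by
    have := hF.continuousAt.sub hG.continuousAt
    simpa [ContinuousAt, F0, G0] using this
  obtain ⟨U, hU, hU0⟩ : ∃ U ∈ 𝓝 (0 : V), ∀ x ∈ U, x ∈ T.proj.ker → x = 0 := by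
    have h1 : ({0} : Set T.proj.ker) ∈ 𝓝 (0 : T.proj.ker) := by simp
    rw [nhds_subtype] at h1
    obtain ⟨U, hU, hs⟩ := h1
    exact ⟨U, hU, fun x hx hk => congrArg Subtype.val (hs (show (⟨x, hk⟩ : T.proj.ker) ∈ _ from hx))⟩
  have he : F =ᶠ[𝓝 0] G := by
    filter_upwards [hFu, hGu, hc hU] with w h1 h2 h3
    refine sub_eq_zero.1 (hU0 _ h3 ?_)
    rw [AddMonoidHom.mem_ker, map_sub, ← h1, ← h2, sub_self]
  exact hF.unique (hG.congr_of_eventuallyEq he)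

theorem HasTangentMap.comp {T : ComplexTorus V X} {u u' : X → X} {A B : V →L[ℂ] V}
    (hA : T.HasTangentMap u A) (hB : T.HasTangentMap u' B) :
    T.HasTangentMap (u ∘ u') (A.comp B) := by
  obtain ⟨F, F0, hF, hFu⟩ := hA
  obtain ⟨G, G0, hG, hGu⟩ := hB
  refine ⟨F ∘ G, by simp [F0, G0], HasFDerivAt.comp 0 (by rwa [G0]) hG, ?_⟩
  have hc : Filter.Tendsto G (𝓝 0) (𝓝 0) := by simpa [ContinuousAt, G0] using hG.continuousAt
  filter_upwards [hGu, hc.eventually hFu] with w h1 h2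
  simp [h1, h2]

theorem IsHolomorphic.comp {T : ComplexTorus V X} {u u' : X → X}
    (hu : T.IsHolomorphic u) (hu' : T.IsHolomorphic u') : T.IsHolomorphic (u ∘ u') := by
  intro v
  obtain ⟨G, hG, hGu⟩ := hu' v
  obtain ⟨F, hF, hFu⟩ := hu (G v)
  refine ⟨F ∘ G, hF.comp hG, ?_⟩
  filter_upwards [hGu, hG.continuousAt.eventually hFu] with w h1 h2
  simp [h1, h2]

theorem IsHolomorphic.exists_tangentMap {T : ComplexTorus V X} {u : X → X}
    (hu : T.IsHolomorphic u) (h0 : u 0 = 0) : ∃ A, T.HasTangentMap u A := by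
  obtain ⟨F, hF, hFu⟩ := hu 0
  have hF0 : T.proj (F 0) = 0 := by
    have := hFu.self_of_nhds
    rw [map_zero, h0] at this
    exact this.symm
  refine ⟨fderiv ℂ F 0, fun w => F w - F 0, by simp,
    hF.differentiableAt.hasFDerivAt.sub_const _, ?_⟩
  filter_upwards [hFu] with w h
  simp [h, hF0]

theorem isHolomorphic_id (T : ComplexTorus V X) : T.IsHolomorphic id :=
  fun v => ⟨id, analyticAt_id, by simp⟩

theorem hasTangentMap_id (T : ComplexTorus V X) :
    T.HasTangentMap id (ContinuousLinearMap.id ℂ V) :=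
  ⟨id, rfl, hasFDerivAt_id 0, by simp⟩

/-- The group `Aut(X, θ)` of automorphisms of the polarized torus: the biholomorphic group
automorphisms `u` such that `u^*θ = θ`, where `u^*H(v, w) = H(du(v), du(w))` for the tangent map
`du` of `u` at the origin. -/
def polarizedAut (T : ComplexTorus V X) (H : V →ₗ[ℂ] V →ₗ⋆[ℂ] ℂ) :
    Subgroup (Equiv.Perm X) where
  carrier := {u | (∀ x y, u (x + y) = u x + u y) ∧ T.IsHolomorphic u ∧ T.IsHolomorphic u.symm ∧
    ∃ A : V →L[ℂ] V, T.HasTangentMap u A ∧ ∀ v w, H (A v) (A w) = H v w}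
  one_mem' := ⟨fun _ _ => rfl, T.isHolomorphic_id, T.isHolomorphic_id,
    ContinuousLinearMap.id ℂ V, T.hasTangentMap_id, fun _ _ => rfl⟩
  mul_mem' := by
    rintro a b ⟨ha₀, ha, ha', A, hA, hAH⟩ ⟨hb₀, hb, hb', B, hB, hBH⟩
    exact ⟨fun x y => by simp [ha₀, hb₀], ha.comp hb, hb'.comp ha', A.comp B, hA.comp hB,
      fun v w => by simp [hAH, hBH]⟩
  inv_mem' := by
    rintro a ⟨ha₀, ha, ha', A, hA, hAH⟩
    have hadd : ∀ x y, a.symm (x + y) = a.symm x + a.symm y := fun x y =>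
      a.injective (by simp [ha₀])
    have h0 : a.symm 0 = 0 := by simpa using hadd 0 0
    obtain ⟨B, hB⟩ := ha'.exists_tangentMap h0
    have hAB : A.comp B = ContinuousLinearMap.id ℂ V := by
      refine (hA.comp hB).unique ?_
      have : (a : X → X) ∘ (a.symm : X → X) = id := by ext x; simp
      rw [this]
      exact T.hasTangentMap_id
    refine ⟨hadd, ha', ha, B, hB, fun v w => ?_⟩
    have h (x : V) : A (B x) = x := congrArg (fun C : V →L[ℂ] V => C x) hAB
    rw [← hAH (B v) (B w), h, h]

/-- `σ` is the analytic representation of the action `ρ`: each group element acts through `σ` by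
the tangent map at the origin of the corresponding automorphism. -/
def IsAnalyticRepresentation {G : Type*} [Group G] (T : ComplexTorus V X)
    {H : V →ₗ[ℂ] V →ₗ⋆[ℂ] ℂ} (ρ : G →* T.polarizedAut H) (σ : Representation ℂ G V) : Prop :=
  ∀ g : G, ∃ A : V →L[ℂ] V, T.HasTangentMap (ρ g : Equiv.Perm X) A ∧ (A : V →ₗ[ℂ] V) = σ g

end ComplexTorus

/-! ## The abelian varieties `E_λ ^ n` -/

/-- `λ = (-1 + √-11) / 2`. -/
noncomputable def lam : ℂ := (-1 + (Real.sqrt 11 : ℂ) * Complex.I) / 2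

/-- The ring `ℤ[λ]`. -/
noncomputable def ZLam : Subalgebra ℤ ℂ := Algebra.adjoin ℤ {lam}

/-- The elliptic curve `E_λ = ℂ / ℤ[λ]`. -/
abbrev ELam : Type := ℂ ⧸ ZLam.toSubring.toAddSubgroup

theorem lam_re : lam.re = -1 / 2 := by simp [lam]

theorem lam_im : lam.im = Real.sqrt 11 / 2 := by simp [lam]

theorem lam_sq : lam * lam = -lam - 3 := by
  have h : (Real.sqrt 11 : ℂ) * (Real.sqrt 11 : ℂ) = 11 := by
    rw [← Complex.ofReal_mul, Real.mul_self_sqrt (by norm_num)]; norm_num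
  unfold lam
  linear_combination (Complex.I ^ 2 / 4) * h + (11 / 4 : ℂ) * Complex.I_sq

theorem lam_mem : lam ∈ ZLam := Algebra.subset_adjoin rfl

theorem exists_of_mem_ZLam {z : ℂ} (hz : z ∈ ZLam) : ∃ a b : ℤ, z = a + b * lam := by
  induction hz using Algebra.adjoin_induction with
  | mem x hx => exact ⟨0, 1, by simpa using hx⟩
  | algebraMap r => exact ⟨r, 0, by simp⟩
  | add x y _ _ hx hy =>
    obtain ⟨a, b, rfl⟩ := hx
    obtain ⟨c, d, rfl⟩ := hy
    exact ⟨a + c, b + d, by push_cast; ring⟩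
  | mul x y _ _ hx hy =>
    obtain ⟨a, b, rfl⟩ := hx
    obtain ⟨c, d, rfl⟩ := hy
    refine ⟨a * c - 3 * (b * d), a * d + b * c - b * d, ?_⟩
    push_cast
    linear_combination ((b : ℂ) * d) * lam_sq

theorem eq_zero_of_mem_ZLam {z : ℂ} (hz : z ∈ ZLam) (h : ‖z‖ < 1) : z = 0 := by
  obtain ⟨a, b, rfl⟩ := exists_of_mem_ZLam hz
  have h1 := (Complex.abs_im_le_norm _).trans_lt h
  have h2 := (Complex.abs_re_le_norm _).trans_lt h
  simp [lam_re, lam_im] at h1 h2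
  have hs : (2 : ℝ) < Real.sqrt 11 := by
    rw [Real.lt_sqrt (by norm_num)]; norm_num
  have hb : |(b : ℝ)| < 1 := by
    rw [abs_of_pos (show (0 : ℝ) < Real.sqrt 11 / 2 by linarith)] at h1
    nlinarith [abs_nonneg (b : ℝ)]
  have hb0 : b = 0 := by
    rw [← Int.cast_abs, ← Int.cast_one, Int.cast_lt] at hb
    exact Int.abs_lt_one_iff.1 hb
  subst hb0
  have ha : |(a : ℝ)| < 1 := by simpa using h2
  have ha0 : a = 0 := by
    rw [← Int.cast_abs, ← Int.cast_one, Int.cast_lt] at ha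
    exact Int.abs_lt_one_iff.1 ha
  simp [ha0]

/-- The complex torus `E_λ ^ n`, with the product of the quotient maps `ℂ → E_λ` as universal
covering. -/
noncomputable def ELamPow (n : ℕ) : ComplexTorus (Fin n → ℂ) (Fin n → ELam) where
  proj := (QuotientAddGroup.mk' ZLam.toSubring.toAddSubgroup).compLeft (Fin n)
  surjective := by
    intro x
    choose v hv using fun i => QuotientAddGroup.mk_surjective (x i)
    exact ⟨v, funext hv⟩
  discrete := by
    refine discreteTopology_of_isOpen_singleton_zero ?_
    refine ⟨Metric.ball 0 1, Metric.isOpen_ball, ?_⟩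
    ext ⟨v, hv⟩
    simp only [Set.mem_preimage, mem_ball_zero_iff, Set.mem_singleton_iff]
    constructor
    · intro h
      have hk : ∀ i, v i ∈ ZLam := fun i =>
        (QuotientAddGroup.eq_zero_iff (N := ZLam.toSubring.toAddSubgroup) (v i)).1
          (congrFun hv i)
      exact Subtype.ext (funext fun i =>
        eq_zero_of_mem_ZLam (hk i) ((norm_le_pi_norm v i).trans_lt h))
    · intro h
      have : v = 0 := congrArg Subtype.val h
      simp [this]
  full := by
    have hmem : ∀ (i : Fin n) (z : ℂ), z ∈ ZLam → Pi.single i z ∈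
        (((QuotientAddGroup.mk' ZLam.toSubring.toAddSubgroup).compLeft (Fin n)).ker :
          Set (Fin n → ℂ)) := by
      intro i z hz
      rw [SetLike.mem_coe, AddMonoidHom.mem_ker]
      ext j
      refine (QuotientAddGroup.eq_zero_iff (N := ZLam.toSubring.toAddSubgroup) _).2 ?_
      by_cases hj : j = i
      · subst hj; simpa using hz
      · simp [Pi.single_eq_of_ne hj]
    rw [eq_top_iff]
    intro v _
    rw [← Finset.univ_sum_single v]
    refine Submodule.sum_mem _ fun i _ => ?_
    have hs : (0 : ℝ) < Real.sqrt 11 := Real.sqrt_pos.2 (by norm_num)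
    have hv : v i = ((v i).re + (v i).im / Real.sqrt 11) • (1 : ℂ)
        + ((v i).im / (Real.sqrt 11 / 2)) • lam := by
      apply Complex.ext
      · rw [Complex.add_re, Complex.smul_re, Complex.smul_re, lam_re, smul_eq_mul, smul_eq_mul,
          Complex.one_re]
        field_simp
        ring
      · rw [Complex.add_im, Complex.smul_im, Complex.smul_im, lam_im, smul_eq_mul, smul_eq_mul,
          Complex.one_im]
        field_simp
        ring
    rw [hv, Pi.single_add, Pi.single_smul, Pi.single_smul]
    exact Submodule.add_mem _
      (Submodule.smul_mem _ _ (Submodule.subset_span (hmem i 1 (one_mem _))))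
      (Submodule.smul_mem _ _ (Submodule.subset_span (hmem i lam lam_mem)))

/-- The form on `ℂ ^ n` attached to a Hermitian matrix `M` over `ℤ[λ]`: it is
`(v, w) ↦ (Im λ)⁻¹ ᵗw̄ M v`. For `M = 1` this is the product principal polarization `θ₀` of
`E_λ ^ n`, and in general `φ_θ₀⁻¹ ∘ φ_θ` is the endomorphism `M`. -/
noncomputable def hermitianForm {n : ℕ} (M : Matrix (Fin n) (Fin n) ℂ) :
    (Fin n → ℂ) →ₗ[ℂ] (Fin n → ℂ) →ₗ⋆[ℂ] ℂ :=
  LinearMap.mk₂'ₛₗ (RingHom.id ℂ) (starRingEnd ℂ)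
    (fun v w => ((lam.im)⁻¹ : ℂ) * (star w ⬝ᵥ M *ᵥ v))
    (by intro v v' w; simp [Matrix.mulVec_add, mul_add])
    (by intro c v w; simp [Matrix.mulVec_smul]; ring)
    (by intro v w w'; simp [mul_add])
    (by intro c v w; simp; ring)

/-! ## Hermitian forms over `ℤ[λ]` -/

/-- `M` is the Gram matrix of a positive definite unimodular Hermitian form on `ℤ[λ] ^ n`
(the determinant being positive and the only positive unit of `ℤ[λ]` being `1`, unimodularity
means that the determinant is `1`). -/
def IsUnimodularHermitian {n : ℕ} (M : Matrix (Fin n) (Fin n) ℂ) : Prop :=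
  (∀ i j, M i j ∈ ZLam) ∧ M.PosDef ∧ M.det = 1

/-- `A` is an automorphism of the Hermitian form on `ℤ[λ] ^ n` with Gram matrix `M`. -/
def IsHermitianAut {n : ℕ} (M A : Matrix (Fin n) (Fin n) ℂ) : Prop :=
  (∀ i j, A i j ∈ ZLam) ∧ IsUnit A ∧ Aᴴ * M * A = M

/-- The Gram matrix of the form `H'` on `ℤ[λ] ^ 5`. -/
noncomputable def gram5 : Matrix (Fin 5) (Fin 5) ℂ :=
  !![3, 1 - star lam, -lam, 1, -star lam;
     1 - lam, 3, -1, -lam, 1;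
     -star lam, -1, 3, lam, -1 + lam;
     1, -star lam, star lam, 3, 1 - star lam;
     -lam, 1, -1 + star lam, 1 - lam, 3]

/-- The indices of the basis `e₁₂, e₁₃, e₁₄, e₁₅, e₂₃, e₂₄, e₂₅, e₃₄, e₃₅, e₄₅` of `⋀² ℤ[λ] ^ 5`. -/
def pairs : Fin 10 → Fin 5 × Fin 5 :=
  ![(0, 1), (0, 2), (0, 3), (0, 4), (1, 2), (1, 3), (1, 4), (2, 3), (2, 4), (3, 4)]

/-- The Gram matrix, in the basis `e_{ij}`, of the form induced on `⋀² ℤ[λ] ^ 5 = ℤ[λ] ^ 10` by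
`H(x₁ ∧ x₂, x₃ ∧ x₄) = H'(x₁, x₃) H'(x₂, x₄) - H'(x₁, x₄) H'(x₂, x₃)`. -/
def wedgeGram (M : Matrix (Fin 5) (Fin 5) ℂ) : Matrix (Fin 10) (Fin 10) ℂ :=
  Matrix.of fun p q =>
    M (pairs p).1 (pairs q).1 * M (pairs p).2 (pairs q).2
      - M (pairs p).1 (pairs q).2 * M (pairs p).2 (pairs q).1

/-! ## The group `PSL(2, 𝔽₁₁)` and its representation `ξ` -/

/-- The group `𝔾 = PSL(2, 𝔽₁₁)`. -/
abbrev GG : Type := Matrix.ProjectiveSpecialLinearGroup (Fin 2) (ZMod 11)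

/-- The class of the matrix `diag(5, 9)`. -/
def elemA : GG :=
  QuotientGroup.mk (⟨!![5, 0; 0, 9], by decide⟩ : Matrix.SpecialLinearGroup (Fin 2) (ZMod 11))

/-- The class of the matrix with rows `(1, 1)` and `(0, 1)`. -/
def elemC : GG :=
  QuotientGroup.mk (⟨!![1, 1; 0, 1], by decide⟩ : Matrix.SpecialLinearGroup (Fin 2) (ZMod 11))

/-- `ζ₁₁ = exp(2πi/11)`. -/
noncomputable def zeta : ℂ := Complex.exp (2 * Real.pi * Complex.I / 11)

/-- `ξ` is the irreducible representation of `𝔾` of dimension `5` whose character takes the value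
`λ = ζ + ζ⁴ + ζ⁵ + ζ⁹ + ζ³` at `c`, in the basis in which `a` acts by a cyclic permutation and `c`
by a diagonal matrix. (There are exactly two irreducible representations of dimension `5`, dual to
each other, and the value of the character at `c` tells them apart.) -/
def IsXi (ξ : Representation ℂ GG (Fin 5 → ℂ)) : Prop :=
  ξ.IsIrreducible ∧
  LinearMap.toMatrix' (ξ elemA) =
    !![0, 0, 0, 0, 1;
       1, 0, 0, 0, 0;
       0, 1, 0, 0, 0;
       0, 0, 1, 0, 0;
       0, 0, 0, 1, 0] ∧
  LinearMap.toMatrix' (ξ elemC) =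
    Matrix.diagonal ![zeta, zeta ^ 4, zeta ^ 5, zeta ^ 9, zeta ^ 3]

/-- The exterior square of a representation. -/
noncomputable def wedgeRep {G V : Type*} [Group G] [AddCommGroup V] [Module ℂ V]
    (ξ : Representation ℂ G V) : Representation ℂ G (⋀[ℂ]^2 V) where
  toFun g := exteriorPower.map 2 (ξ g)
  map_one' := by rw [map_one]; exact exteriorPower.map_id
  map_mul' g h := by rw [map_mul]; exact exteriorPower.map_comp (ξ h) (ξ g)

/-! The group acts already on the rank 5 lattice. Three explicit matrices `matA`, `matC`, `matW`
over `ℤ[λ]` preserve `H'` and satisfy relations that hold for the classes of `diag(5, 9)`, a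
transvection and the Weyl element. The Bruhat decomposition turns any solution of these relations
into a homomorphism from `PSL(2, 𝔽₁₁)` (`Relations.leftCompatible`, `Relations.hom`), so a few
integral matrix identities yield the isometric representation `intRep`.

The second compound matrix is multiplicative (`compound_mul`) and commutes with conjugate
transposition. It therefore carries a triangular factorization of `12 H'` to one of `144 H`, and
isometries of `H'` to isometries of `H`. Positivity is read off the diagonal factor, and determinant
1 from comparing determinants. The polarization is principal because `ℤ[λ]` is self-dual for `Im(w̄
z) / Im λ` and a unimodular matrix has an integral inverse (`mem_dualLattice_iff`).

To recognize `ξ`, let `C` be the complexified `matC`: the scalar identity `C + C³ + C⁴ + C⁵ + C⁹ =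
λ`, with the Gaussian period `period_zeta`, forces its eigenvalues to be `ζ ^ k` with `k` a
quadratic residue. As `matA` sends the `μ`-eigenspace to the `μ⁴`-eigenspace, the orbit of a
`ζ`-eigenvector is the required basis (`exists_eigenbasis`).

On the exterior square the transvection has ten distinct eigenvalues, so invariant subspaces are
spanned by eigenvectors. `matA` permutes these in two orbits, residues and nonresidues, and `matW`
links the orbits in both directions; hence irreducibility. Faithfulness follows from the simplicity
of the group. -/

/-! ## A presentation of `PSL(2, 𝔽₁₁)` -/

namespace PSLPresentation

local notation "SL₂" => Matrix.SpecialLinearGroup (Fin 2) (ZMod 11)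

instance : Fact (Nat.Prime 11) := ⟨by norm_num⟩

/-- The discrete logarithm in basis `5` on `𝔽₁₁ˣ / {±1}`. -/
def dlog : ZMod 11 → ℕ := ![0, 0, 4, 2, 3, 1, 1, 3, 2, 4, 0]

theorem dlog_mul : ∀ s t : ZMod 11, s ≠ 0 → t ≠ 0 →
    dlog (s * t) % 5 = (dlog s + dlog t) % 5 := by decide

/-- Since `5² = 3` in `𝔽₁₁`, `s = ±5 ^ k` gives `s² = 3 ^ k`. This matches conjugation by `a ^ k`,
which raises `c` to the power `3 ^ k`, with the action of `diag(s, s⁻¹)` on transvections. -/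
theorem three_pow_dlog : ∀ s : ZMod 11, s ≠ 0 → 3 ^ dlog s = s * s := by decide

theorem dlog_neg : ∀ s : ZMod 11, dlog (-s) = dlog s := by decide

theorem dlog_eq_zero : ∀ s : ZMod 11, s ^ 2 = 1 → dlog s = 0 := by decide

/-- `-1` is not a square modulo 11, so up to sign every unit is a square. -/
theorem eq_sq_or_neg_sq : ∀ t : ZMod 11, t ≠ 0 → ∃ s, s ≠ 0 ∧ (t = s * s ∨ t = -(s * s)) := by
  decide

variable {Γ : Type*} [Group Γ]

/-- The relations satisfied by the classes `a`, `c`, `w` of `diag(5, 9)`, of the standard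
transvection and of the Weyl element of `PSL(2, 𝔽₁₁)`. -/
structure Relations (a c w : Γ) : Prop where
  a_pow : a ^ 5 = 1
  c_pow : c ^ 11 = 1
  w_sq : w * w = 1
  a_c : a * c = c ^ 3 * a
  w_a : w * a = a⁻¹ * w
  c_w : (c * w) ^ 3 = 1

/-- The image of the transvection with parameter `t`. -/
def unip (c : Γ) (t : ZMod 11) : Γ := c ^ t.val

/-- The image of `diag(s, s⁻¹)`. -/
def tor (a : Γ) (s : ZMod 11) : Γ := a ^ dlog s

/-- The extension of `a`, `c`, `w` to `SL(2, 𝔽₁₁)` through the Bruhat decomposition. -/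
def bruhat (a c w : Γ) (g : SL₂) : Γ :=
  if g 1 0 = 0 then tor a (g 0 0) * unip c (g 0 1 / g 0 0)
  else unip c (g 0 0 / g 1 0) * w * tor a (g 1 0) * unip c (g 1 1 / g 1 0)

namespace Relations

variable {a c w : Γ} (h : Relations a c w)
include h

theorem unip_add (s t : ZMod 11) : unip c (s + t) = unip c s * unip c t := by
  unfold unip
  rw [← pow_add, ZMod.val_add, ← pow_eq_pow_mod _ h.c_pow]

omit h in
theorem unip_zero (c : Γ) : unip c 0 = 1 := by simp [unip]

omit h in
theorem unip_one (c : Γ) : unip c 1 = c := pow_one c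

theorem unip_neg (t : ZMod 11) : unip c (-t) = (unip c t)⁻¹ := by
  rw [eq_inv_iff_mul_eq_one, ← h.unip_add, neg_add_cancel, unip_zero]

theorem tor_mul {s t : ZMod 11} (hs : s ≠ 0) (ht : t ≠ 0) :
    tor a (s * t) = tor a s * tor a t := by
  unfold tor
  rw [← pow_add, pow_eq_pow_mod _ h.a_pow, dlog_mul s t hs ht, ← pow_eq_pow_mod _ h.a_pow]

omit h in
theorem tor_neg (a : Γ) (s : ZMod 11) : tor a (-s) = tor a s := by rw [tor, dlog_neg, tor]

omit h in
theorem tor_one (a : Γ) : tor a 1 = 1 := pow_zero a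

theorem tor_inv {s : ZMod 11} (hs : s ≠ 0) : tor a s⁻¹ = (tor a s)⁻¹ := by
  rw [eq_inv_iff_mul_eq_one, ← h.tor_mul (inv_ne_zero hs) hs, inv_mul_cancel₀ hs, tor_one]

theorem a_unip (t : ZMod 11) : a * unip c t = unip c (3 * t) * a := by
  have h1 : a * c * a⁻¹ = c ^ 3 := by rw [h.a_c, mul_inv_cancel_right]
  have h2 : a * unip c t * a⁻¹ = unip c (3 * t) := by
    rw [unip, ← conj_pow, h1, ← pow_mul, unip, ZMod.val_mul, ← pow_eq_pow_mod _ h.c_pow]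
    rfl
  rw [← h2, inv_mul_cancel_right]

theorem tor_unip {s : ZMod 11} (hs : s ≠ 0) (t : ZMod 11) :
    tor a s * unip c t = unip c (s * s * t) * tor a s := by
  have key (k : ℕ) : a ^ k * unip c t = unip c (3 ^ k * t) * a ^ k := by
    induction k with
    | zero => simp
    | succ k ih => rw [pow_succ', mul_assoc, ih, ← mul_assoc, h.a_unip, pow_succ', mul_assoc,
        mul_assoc]
  rw [tor, key, three_pow_dlog s hs]

theorem w_tor {s : ZMod 11} (hs : s ≠ 0) : w * tor a s = tor a s⁻¹ * w := by
  have h1 : w * a * w⁻¹ = a⁻¹ := by rw [h.w_a, mul_inv_cancel_right]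
  have h2 : w * tor a s * w⁻¹ = (tor a s)⁻¹ := by rw [tor, ← conj_pow, h1, inv_pow]
  rw [h.tor_inv hs, ← h2, inv_mul_cancel_right]

theorem w_inv : w⁻¹ = w := inv_eq_of_mul_eq_one_left h.w_sq

/-- A rearrangement of `(c w)³ = 1`, using that `w` is an involution. -/
theorem w_unip_one_w : w * unip c 1 * w = unip c (-1) * w * unip c (-1) := by
  have h3 : c * w * (c * w) * (c * w) = 1 := by rw [← h.c_w, pow_three, mul_assoc]
  rw [h.unip_neg, unip_one]
  have := eq_inv_of_mul_eq_one_left h3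
  calc w * c * w = c⁻¹ * (c * w * (c * w)) := by group
    _ = c⁻¹ * (w⁻¹ * c⁻¹) := by rw [this, mul_inv_rev]
    _ = _ := by rw [h.w_inv, mul_assoc]

theorem w_unip_neg_one_w : w * unip c (-1) * w = unip c 1 * w * unip c 1 := by
  have := congrArg (·⁻¹) h.w_unip_one_w
  simp only [mul_inv_rev, h.w_inv, ← h.unip_neg, neg_neg] at this
  simpa [mul_assoc] using this

/-- The one rewriting rule needed when `w` meets a big-cell element. Torus conjugation rescales the
parameter by squares, so only `t = 1` and `t = -1` matter, and these are the relation `(c w)³ = 1`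
and its inverse. -/
theorem w_unip_w {t : ZMod 11} (ht : t ≠ 0) :
    w * unip c t * w = unip c (-t⁻¹) * w * tor a t * unip c (-t⁻¹) := by
  obtain ⟨s, hs, hst⟩ := eq_sq_or_neg_sq t ht
  have hs' := inv_ne_zero hs
  have key (ε : ZMod 11) (hε : ε * ε = 1)
      (hw : w * unip c ε * w = unip c (-ε) * w * unip c (-ε)) :
      w * unip c (ε * (s * s)) * w
        = unip c (-(ε * (s * s))⁻¹) * w * tor a (s * s) * unip c (-(ε * (s * s))⁻¹) := by
    have hε0 : ε ≠ 0 := by rintro rfl; exact absurd hε (by decide)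
    have e1 : unip c (ε * (s * s)) = tor a s * unip c ε * tor a s⁻¹ := by
      rw [h.tor_unip hs, h.tor_inv hs, mul_inv_cancel_right, mul_comm]
    have e2 : -(ε * (s * s))⁻¹ = s⁻¹ * s⁻¹ * -ε := by
      rw [mul_inv, mul_inv, inv_eq_of_mul_eq_one_left hε]; ring
    have e3 : unip c (-ε) * tor a s = tor a s * unip c (s⁻¹ * s⁻¹ * -ε) := by
      rw [h.tor_unip hs]; congr 2; field_simp
    calc w * unip c (ε * (s * s)) * w
        = w * tor a s * unip c ε * (tor a s⁻¹ * w) := by rw [e1]; group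
      _ = (tor a s⁻¹ * w) * unip c ε * (w * tor a s) := by rw [← h.w_tor hs]
      _ = tor a s⁻¹ * (w * unip c ε * w) * tor a s := by simp only [mul_assoc]
      _ = (tor a s⁻¹ * unip c (-ε)) * w * (unip c (-ε) * tor a s) := by rw [hw]; group
      _ = unip c (s⁻¹ * s⁻¹ * -ε) * (tor a s⁻¹ * w) * tor a s * unip c (s⁻¹ * s⁻¹ * -ε) := by
        rw [e3, h.tor_unip hs']; group
      _ = _ := by rw [← h.w_tor hs, e2, h.tor_mul hs hs]; group
  rcases hst with rfl | rfl
  · simpa using key 1 (by decide) h.w_unip_one_w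
  · have := key (-1) (by decide) (by rw [neg_neg]; exact h.w_unip_neg_one_w)
    rw [neg_one_mul] at this
    rw [this, tor_neg]

end Relations

/-- The transvection with parameter `t`. -/
def slUnip (t : ZMod 11) : SL₂ := ⟨!![1, t; 0, 1], by simp [Matrix.det_fin_two]⟩

/-- The diagonal matrix `diag(s, s⁻¹)`. -/
def slTor (s : ZMod 11) (hs : s ≠ 0) : SL₂ :=
  ⟨!![s, 0; 0, s⁻¹], by simp [Matrix.det_fin_two, mul_inv_cancel₀ hs]⟩

/-- The Weyl element. -/
def slW : SL₂ := ⟨!![0, 1; -1, 0], by simp [Matrix.det_fin_two]⟩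

theorem coe_slUnip (t : ZMod 11) :
    (slUnip t : Matrix (Fin 2) (Fin 2) (ZMod 11)) = !![1, t; 0, 1] := rfl

theorem coe_slTor (s : ZMod 11) (hs : s ≠ 0) :
    (slTor s hs : Matrix (Fin 2) (Fin 2) (ZMod 11)) = !![s, 0; 0, s⁻¹] := rfl

theorem coe_slW : (slW : Matrix (Fin 2) (Fin 2) (ZMod 11)) = !![0, 1; -1, 0] := rfl

namespace Relations

variable {a c w : Γ} (h : Relations a c w)
include h

/-- `bruhat` is compatible with left multiplication by `s`. -/
def LeftCompatible (a c w : Γ) (s : SL₂) : Prop :=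
  ∀ g, bruhat a c w (s * g) = bruhat a c w s * bruhat a c w g

omit h in
theorem LeftCompatible.mul {s t : SL₂} (hs : LeftCompatible a c w s)
    (ht : LeftCompatible a c w t) : LeftCompatible a c w (s * t) := fun g => by
  rw [mul_assoc, hs, ht, hs, mul_assoc]

omit h in
theorem bruhat_slUnip (t : ZMod 11) : bruhat a c w (slUnip t) = unip c t := by
  simp [bruhat, coe_slUnip, tor_one]

omit h in
theorem bruhat_slTor (s : ZMod 11) (hs : s ≠ 0) : bruhat a c w (slTor s hs) = tor a s := by
  simp [bruhat, coe_slTor, unip_zero]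

omit h in
theorem bruhat_slW : bruhat a c w slW = w := by
  simp [bruhat, coe_slW, unip_zero, tor_neg, tor_one]

omit h in
theorem det_eq (g : SL₂) : g 0 0 * g 1 1 - g 0 1 * g 1 0 = 1 := by
  rw [← Matrix.det_fin_two]; exact g.2

theorem leftCompatible_slUnip (u : ZMod 11) : LeftCompatible a c w (slUnip u) := fun g => by
  have hdet := det_eq g
  rw [bruhat_slUnip]
  unfold bruhat
  simp only [coe_slUnip, Matrix.SpecialLinearGroup.coe_mul, Matrix.mul_apply, Fin.sum_univ_two]
  simp only [Matrix.of_apply, Matrix.cons_val', Matrix.cons_val_zero, Matrix.cons_val_one,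
    Matrix.cons_val_fin_one, zero_mul, one_mul, zero_add]
  split_ifs with h0
  · rw [h0] at hdet ⊢
    have hα : g 0 0 ≠ 0 := by intro hα; simp [hα] at hdet
    rw [mul_zero, add_zero, ← mul_assoc]
    have : unip c u * tor a (g 0 0) = tor a (g 0 0) * unip c (u * g 1 1 / g 0 0) := by
      rw [h.tor_unip hα]; congr 2; field_simp; linear_combination -u * hdet
    rw [this, mul_assoc, ← h.unip_add]; congr 2; ring
  · rw [add_div, mul_div_cancel_right₀ _ h0, add_comm, h.unip_add]; group

theorem leftCompatible_slTor (s : ZMod 11) (hs : s ≠ 0) :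
    LeftCompatible a c w (slTor s hs) := fun g => by
  have hdet := det_eq g
  rw [bruhat_slTor]
  unfold bruhat
  simp only [coe_slTor, Matrix.SpecialLinearGroup.coe_mul, Matrix.mul_apply, Fin.sum_univ_two]
  simp only [Matrix.of_apply, Matrix.cons_val', Matrix.cons_val_zero, Matrix.cons_val_one,
    Matrix.cons_val_fin_one, zero_mul, zero_add, add_zero]
  by_cases h0 : g 1 0 = 0
  · rw [h0] at hdet ⊢
    have hα : g 0 0 ≠ 0 := by intro hα; simp [hα] at hdet
    rw [if_pos (by simp), if_pos rfl, h.tor_mul hs hα, mul_assoc,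
      mul_div_mul_left _ _ hs]
  · rw [if_neg (mul_ne_zero (inv_ne_zero hs) h0), if_neg h0, ← mul_assoc, ← mul_assoc, ← mul_assoc,
      h.tor_unip hs, h.tor_mul (inv_ne_zero hs) h0, ← mul_assoc,
      mul_assoc (unip c _) w, h.w_tor (inv_ne_zero hs), inv_inv,
      mul_div_mul_left _ _ (inv_ne_zero hs), ← mul_assoc]
    congr 5
    field_simp

/-- The Weyl element either moves `g` between the Borel subgroup and the big cell or keeps it in the
big cell. Only the last case, where both entries of the first column are nonzero, needs `w_unip_w`.
-/
theorem leftCompatible_slW : LeftCompatible a c w slW := fun g => by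
  have hdet := det_eq g
  rw [bruhat_slW]
  unfold bruhat
  simp only [coe_slW, Matrix.SpecialLinearGroup.coe_mul, Matrix.mul_apply, Fin.sum_univ_two]
  simp only [Matrix.of_apply, Matrix.cons_val', Matrix.cons_val_zero, Matrix.cons_val_one,
    Matrix.cons_val_fin_one, zero_mul, zero_add, add_zero, one_mul, neg_one_mul]
  by_cases hγ : g 1 0 = 0
  · rw [hγ] at hdet ⊢
    have hα : g 0 0 ≠ 0 := by intro hα; simp [hα] at hdet
    rw [if_neg (neg_ne_zero.2 hα), if_pos rfl, zero_div, unip_zero, one_mul, tor_neg, neg_div_neg_eq,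
      mul_assoc]
  · by_cases hα : g 0 0 = 0
    · rw [if_pos (by simp [hα]), if_neg hγ, hα, zero_div, unip_zero, one_mul, ← mul_assoc,
        ← mul_assoc, h.w_sq, one_mul]
    · rw [if_neg (neg_ne_zero.2 hα), if_neg hγ, ← mul_assoc, ← mul_assoc, ← mul_assoc,
        h.w_unip_w (div_ne_zero hα hγ), tor_neg, neg_div_neg_eq, inv_div]
      have e1 : unip c (-(g 1 0 / g 0 0)) * tor a (g 1 0)
          = tor a (g 1 0) * unip c (-(1 / (g 0 0 * g 1 0))) := by
        rw [h.tor_unip hγ]; congr 2; field_simp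
      have e2 : tor a (g 0 0) = tor a (g 0 0 / g 1 0) * tor a (g 1 0) := by
        rw [← h.tor_mul (div_ne_zero hα hγ) hγ, div_mul_cancel₀ _ hγ]
      have e3 : g 0 1 / g 0 0 = -(1 / (g 0 0 * g 1 0)) + g 1 1 / g 1 0 := by
        field_simp; linear_combination -hdet
      rw [mul_assoc _ (unip c _) (tor a _), e1, e2, e3, h.unip_add, div_neg]
      simp only [mul_assoc]

/-- Left compatibility is stable under products, so it suffices to factor `g` into transvections,
diagonal matrices and the Weyl element. -/
theorem leftCompatible (g : SL₂) : LeftCompatible a c w g := by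
  have hdet := det_eq g
  by_cases hγ : g 1 0 = 0
  · rw [hγ] at hdet
    have hα : g 0 0 ≠ 0 := by intro hα; simp [hα] at hdet
    have : g = slTor _ hα * slUnip (g 0 1 / g 0 0) := by
      ext i j
      fin_cases i <;> fin_cases j <;> simp [coe_slTor, coe_slUnip, Matrix.mul_apply, hγ]
      · field_simp
      · field_simp; linear_combination hdet
    rw [this]
    exact (h.leftCompatible_slTor _ _).mul (h.leftCompatible_slUnip _)
  -- The exact factorization in `SL₂` needs `-γ` in the torus, whereas `bruhat` uses `γ`; `tor` does
  -- not see the sign.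
  · have : g = slUnip (g 0 0 / g 1 0) * slW * slTor _ (neg_ne_zero.2 hγ)
        * slUnip (g 1 1 / g 1 0) := by
      ext i j
      fin_cases i <;> fin_cases j <;>
        simp [coe_slTor, coe_slUnip, coe_slW, Matrix.mul_apply, Fin.sum_univ_two]
      · field_simp
      · field_simp; linear_combination -hdet
      · field_simp
    rw [this]
    exact (((h.leftCompatible_slUnip _).mul h.leftCompatible_slW).mul
      (h.leftCompatible_slTor _ _)).mul (h.leftCompatible_slUnip _)

/-- The homomorphism `SL(2, 𝔽₁₁) → Γ` attached to a solution of the relations. -/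
def slHom : SL₂ →* Γ where
  toFun := bruhat a c w
  map_one' := by simp [bruhat, tor_one, unip_zero]
  map_mul' g g' := h.leftCompatible g g'

/-- The homomorphism `PSL(2, 𝔽₁₁) → Γ` attached to a solution of the relations. -/
def hom : GG →* Γ :=
  QuotientGroup.lift _ h.slHom (by
    intro g hg
    -- Central elements are scalars `r` with `r² = 1`, where `dlog` vanishes.
    obtain ⟨r, hr, hrg⟩ := Matrix.SpecialLinearGroup.mem_center_iff.1 hg
    have h00 : g 0 0 = r := by rw [← hrg]; simp
    have h01 : g 0 1 = 0 := by rw [← hrg]; simp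
    have h10 : g 1 0 = 0 := by rw [← hrg]; simp
    show bruhat a c w g = 1
    rw [bruhat, if_pos h10, h00, h01, zero_div, unip_zero, tor, dlog_eq_zero r hr, pow_zero, one_mul])

theorem hom_mk (g : SL₂) : h.hom (QuotientGroup.mk g) = bruhat a c w g := rfl

theorem hom_elemA : h.hom elemA = a := by
  have h1 : dlog 5 = 1 := by decide
  -- In `𝔽₁₁` the inverse of 5 is 9, so this torus element is `diag(5, 9)`.
  refine (h.hom_mk (slTor 5 (by decide))).trans ?_
  rw [bruhat_slTor, tor, h1, pow_one]

theorem hom_elemC : h.hom elemC = c := by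
  refine (h.hom_mk (slUnip 1)).trans ?_
  rw [bruhat_slUnip, unip_one]

theorem hom_slW : h.hom (QuotientGroup.mk slW) = w := by rw [hom_mk, bruhat_slW]

end Relations

end PSLPresentation

/-! ## Integral matrices -/

/-- A computable model of `ℤ[λ]`. -/
abbrev QLam : Type := QuadraticAlgebra ℤ (-3) (-1)

/-- The embedding of the computable model of `ℤ[λ]` in `ℂ`. -/
noncomputable def toC : QLam →+* ℂ :=
  (QuadraticAlgebra.lift (R := ℤ) (A := ℂ) ⟨lam, by rw [lam_sq]; simp; ring⟩).toRingHom

theorem toC_apply (z : QLam) : toC z = z.re + z.im * lam := by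
  simp [toC]

theorem star_lam : star lam = -1 - lam := by
  apply Complex.ext <;> simp [lam_re, lam_im]; norm_num

theorem toC_star (z : QLam) : toC (star z) = star (toC z) := by
  simp only [toC_apply, QuadraticAlgebra.re_star, QuadraticAlgebra.im_star, star_add, star_mul',
    star_intCast, star_lam]
  push_cast
  ring

theorem toC_injective : Function.Injective toC := by
  rw [injective_iff_map_eq_zero]
  intro z hz
  rw [toC_apply] at hz
  have him := congrArg Complex.im hz
  have hre := congrArg Complex.re hz
  simp [lam_re, lam_im] at him hre
  ext <;> simp_all

theorem toC_mem (z : QLam) : toC z ∈ ZLam := by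
  rw [toC_apply]
  exact add_mem (intCast_mem _ _) (mul_mem (intCast_mem _ _) lam_mem)

theorem map_toC_conjTranspose {m n : Type*} (A : Matrix m n QLam) :
    (Aᴴ).map toC = (A.map toC)ᴴ := by
  ext i j; simp [toC_star]

/-- The Gram matrix of `H'` over the ring `ℤ[λ]`. -/
def gramR : Matrix (Fin 5) (Fin 5) QLam :=
  !![⟨3, 0⟩, ⟨2, 1⟩, ⟨0, -1⟩, ⟨1, 0⟩, ⟨1, 1⟩;
     ⟨1, -1⟩, ⟨3, 0⟩, ⟨-1, 0⟩, ⟨0, -1⟩, ⟨1, 0⟩;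
     ⟨1, 1⟩, ⟨-1, 0⟩, ⟨3, 0⟩, ⟨0, 1⟩, ⟨-1, 1⟩;
     ⟨1, 0⟩, ⟨1, 1⟩, ⟨-1, -1⟩, ⟨3, 0⟩, ⟨2, 1⟩;
     ⟨0, -1⟩, ⟨1, 0⟩, ⟨-2, -1⟩, ⟨1, -1⟩, ⟨3, 0⟩]

/-- The upper triangular factor in a Cholesky decomposition of `12 H'`. -/
def cholR : Matrix (Fin 5) (Fin 5) QLam :=
  !![⟨3, 0⟩, ⟨2, 1⟩, ⟨0, -1⟩, ⟨1, 0⟩, ⟨1, 1⟩;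
     ⟨0, 0⟩, ⟨4, 0⟩, ⟨0, 2⟩, ⟨-1, -2⟩, ⟨-1, -1⟩;
     ⟨0, 0⟩, ⟨0, 0⟩, ⟨2, 0⟩, ⟨1, 1⟩, ⟨0, 1⟩;
     ⟨0, 0⟩, ⟨0, 0⟩, ⟨0, 0⟩, ⟨2, 0⟩, ⟨1, 1⟩;
     ⟨0, 0⟩, ⟨0, 0⟩, ⟨0, 0⟩, ⟨0, 0⟩, ⟨1, 0⟩]

/-- The image of the class of `diag(5, 9)`. -/
def matA : Matrix (Fin 5) (Fin 5) QLam :=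
  !![⟨-1, 0⟩, ⟨0, 0⟩, ⟨-1, 1⟩, ⟨0, 0⟩, ⟨-1, 0⟩;
     ⟨1, 0⟩, ⟨0, 0⟩, ⟨0, -1⟩, ⟨0, 0⟩, ⟨0, 0⟩;
     ⟨0, 1⟩, ⟨-1, 0⟩, ⟨2, 1⟩, ⟨-1, 0⟩, ⟨-1, 0⟩;
     ⟨0, 0⟩, ⟨0, 0⟩, ⟨0, 1⟩, ⟨-1, 0⟩, ⟨-1, 0⟩;
     ⟨-1, 0⟩, ⟨0, 0⟩, ⟨-2, 0⟩, ⟨0, -1⟩, ⟨0, -1⟩]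

/-- The image of the class of the Weyl element. -/
def matW : Matrix (Fin 5) (Fin 5) QLam :=
  !![⟨1, 0⟩, ⟨0, 0⟩, ⟨0, 0⟩, ⟨0, 0⟩, ⟨0, 1⟩;
     ⟨-1, 0⟩, ⟨0, 0⟩, ⟨-1, 0⟩, ⟨0, 0⟩, ⟨-1, -1⟩;
     ⟨-1, 0⟩, ⟨-1, 0⟩, ⟨0, 0⟩, ⟨0, 0⟩, ⟨1, 0⟩;
     ⟨0, 0⟩, ⟨0, 0⟩, ⟨0, 0⟩, ⟨1, 0⟩, ⟨1, 1⟩;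
     ⟨0, 0⟩, ⟨0, 0⟩, ⟨0, 0⟩, ⟨0, 0⟩, ⟨-1, 0⟩]

/-- The image of the class of the standard transvection. -/
def matC : Matrix (Fin 5) (Fin 5) QLam :=
  !![⟨-1, 0⟩, ⟨-1, 0⟩, ⟨0, 0⟩, ⟨0, 1⟩, ⟨0, 0⟩;
     ⟨1, 0⟩, ⟨1, 0⟩, ⟨0, 0⟩, ⟨-1, -1⟩, ⟨0, 0⟩;
     ⟨0, 0⟩, ⟨1, 0⟩, ⟨0, 0⟩, ⟨1, 0⟩, ⟨0, 0⟩;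
     ⟨0, 0⟩, ⟨0, 0⟩, ⟨0, 0⟩, ⟨0, 1⟩, ⟨-1, 0⟩;
     ⟨0, 0⟩, ⟨0, 0⟩, ⟨1, 0⟩, ⟨-1, 0⟩, ⟨0, 0⟩]

/-- The matrix `matC ^ 2`. -/
def matC2 : Matrix (Fin 5) (Fin 5) QLam :=
  !![⟨0, 0⟩, ⟨0, 0⟩, ⟨0, 0⟩, ⟨-2, -1⟩, ⟨0, -1⟩;
     ⟨0, 0⟩, ⟨0, 0⟩, ⟨0, 0⟩, ⟨2, 0⟩, ⟨1, 1⟩;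
     ⟨1, 0⟩, ⟨1, 0⟩, ⟨0, 0⟩, ⟨-1, 0⟩, ⟨-1, 0⟩;
     ⟨0, 0⟩, ⟨0, 0⟩, ⟨-1, 0⟩, ⟨-2, -1⟩, ⟨0, -1⟩;
     ⟨0, 0⟩, ⟨1, 0⟩, ⟨0, 0⟩, ⟨1, -1⟩, ⟨1, 0⟩]

/-- The matrix `matC ^ 3`. -/
def matC3 : Matrix (Fin 5) (Fin 5) QLam :=
  !![⟨0, 0⟩, ⟨0, 0⟩, ⟨0, -1⟩, ⟨3, 0⟩, ⟨2, 1⟩;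
     ⟨0, 0⟩, ⟨0, 0⟩, ⟨1, 1⟩, ⟨-1, 1⟩, ⟨-2, 0⟩;
     ⟨0, 0⟩, ⟨0, 0⟩, ⟨-1, 0⟩, ⟨0, -1⟩, ⟨1, 0⟩;
     ⟨0, 0⟩, ⟨-1, 0⟩, ⟨0, -1⟩, ⟨2, 0⟩, ⟨2, 1⟩;
     ⟨1, 0⟩, ⟨1, 0⟩, ⟨1, 0⟩, ⟨1, 1⟩, ⟨-1, 1⟩]

/-- The matrix `matC ^ 4`. -/
def matC4 : Matrix (Fin 5) (Fin 5) QLam :=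
  !![⟨0, 0⟩, ⟨0, -1⟩, ⟨2, 1⟩, ⟨-2, 1⟩, ⟨-3, 0⟩;
     ⟨0, 0⟩, ⟨1, 1⟩, ⟨-2, 0⟩, ⟨0, -1⟩, ⟨1, -1⟩;
     ⟨0, 0⟩, ⟨-1, 0⟩, ⟨1, 0⟩, ⟨1, 1⟩, ⟨0, 1⟩;
     ⟨-1, 0⟩, ⟨-1, -1⟩, ⟨2, 1⟩, ⟨-1, 1⟩, ⟨-2, 0⟩;
     ⟨0, 0⟩, ⟨1, 0⟩, ⟨-1, 1⟩, ⟨-2, -1⟩, ⟨-1, -1⟩]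

/-- The matrix `matC ^ 5`. -/
def matC5 : Matrix (Fin 5) (Fin 5) QLam :=
  !![⟨0, -1⟩, ⟨2, 0⟩, ⟨-3, 0⟩, ⟨-1, -2⟩, ⟨2, -1⟩;
     ⟨1, 1⟩, ⟨-1, 1⟩, ⟨1, -1⟩, ⟨2, 1⟩, ⟨0, 1⟩;
     ⟨-1, 0⟩, ⟨0, 0⟩, ⟨0, 1⟩, ⟨-1, 0⟩, ⟨-1, -1⟩;
     ⟨0, -1⟩, ⟨2, 0⟩, ⟨-2, 0⟩, ⟨-1, -1⟩, ⟨1, -1⟩;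
     ⟨1, 0⟩, ⟨0, 1⟩, ⟨-1, -1⟩, ⟨2, 0⟩, ⟨2, 1⟩]

/-- The matrix `matC ^ 9`. -/
def matC9 : Matrix (Fin 5) (Fin 5) QLam :=
  !![⟨1, 2⟩, ⟨-1, 1⟩, ⟨1, 0⟩, ⟨0, 0⟩, ⟨-1, 0⟩;
     ⟨-2, -1⟩, ⟨-1, -1⟩, ⟨0, 0⟩, ⟨0, 0⟩, ⟨1, 0⟩;
     ⟨1, 0⟩, ⟨0, 0⟩, ⟨0, 0⟩, ⟨-1, 0⟩, ⟨0, 0⟩;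
     ⟨1, 1⟩, ⟨0, 1⟩, ⟨0, 0⟩, ⟨0, 0⟩, ⟨0, 0⟩;
     ⟨-2, 0⟩, ⟨-2, -1⟩, ⟨0, 0⟩, ⟨0, 0⟩, ⟨0, 0⟩]

/-- The matrix `matA ^ 2`. -/
def matA2 : Matrix (Fin 5) (Fin 5) QLam :=
  !![⟨-1, -2⟩, ⟨1, -1⟩, ⟨-2, -1⟩, ⟨1, 0⟩, ⟨2, 0⟩;
     ⟨2, 1⟩, ⟨0, 1⟩, ⟨2, 0⟩, ⟨0, 1⟩, ⟨-1, 1⟩;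
     ⟨-3, 0⟩, ⟨-2, -1⟩, ⟨0, 1⟩, ⟨-1, 0⟩, ⟨-1, -1⟩;
     ⟨-2, -1⟩, ⟨0, -1⟩, ⟨-1, 0⟩, ⟨1, 0⟩, ⟨1, 0⟩;
     ⟨1, -1⟩, ⟨2, 0⟩, ⟨0, 0⟩, ⟨-1, 0⟩, ⟨0, 0⟩]

/-- The matrix `matA ^ 4`. -/
def matA4 : Matrix (Fin 5) (Fin 5) QLam :=
  !![⟨0, 0⟩, ⟨1, 1⟩, ⟨0, 0⟩, ⟨3, 1⟩, ⟨0, 1⟩;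
     ⟨0, 0⟩, ⟨-1, 0⟩, ⟨-1, 0⟩, ⟨-2, 0⟩, ⟨-1, -1⟩;
     ⟨0, 0⟩, ⟨1, 0⟩, ⟨0, 0⟩, ⟨0, -1⟩, ⟨1, 0⟩;
     ⟨1, 0⟩, ⟨2, 1⟩, ⟨0, 0⟩, ⟨2, 0⟩, ⟨1, 1⟩;
     ⟨-1, 0⟩, ⟨-2, 0⟩, ⟨0, 0⟩, ⟨0, 1⟩, ⟨-1, 0⟩]

/-- The diagonal factor in a Cholesky decomposition of `12 H'`. -/
def cholDiag : Fin 5 → QLam := ![4, 1, 3, 3, 3]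

theorem gram5_eq : gram5 = gramR.map toC := by
  ext i j
  fin_cases i <;> fin_cases j <;>
    simp [gram5, gramR, toC_apply, -Complex.star_def, star_lam] <;> ring

theorem cholR_spec : cholRᴴ * Matrix.diagonal cholDiag * cholR = 12 • gramR := by decide +kernel

theorem cholR_triangular : cholR.BlockTriangular id := by
  -- An equality of matrices with entries in `QLam` is decidable, so triangularity becomes a finite
  -- check.
  have h : cholR = Matrix.of fun i j => if j < i then 0 else cholR i j := by decide +kernel
  intro i j hij
  exact (congrFun (congrFun h i) j).trans (if_pos hij)

/-- The exponents 1, 2, 3, 4, 5, 9, 11 form an addition chain through all the quadratic residues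
modulo 11, so each check is a single matrix product. -/
theorem matC_mul_matC : matC * matC = matC2 := by decide +kernel
theorem matC2_mul_matC : matC2 * matC = matC3 := by decide +kernel
theorem matC2_mul_matC2 : matC2 * matC2 = matC4 := by decide +kernel
theorem matC4_mul_matC : matC4 * matC = matC5 := by decide +kernel
theorem matC5_mul_matC4 : matC5 * matC4 = matC9 := by decide +kernel
theorem matC9_mul_matC2 : matC9 * matC2 = 1 := by decide +kernel
theorem matA_mul_matA : matA * matA = matA2 := by decide +kernel
theorem matA2_mul_matA2 : matA2 * matA2 = matA4 := by decide +kernel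
theorem matA4_mul_matA : matA4 * matA = 1 := by decide +kernel
theorem matW_mul_matW : matW * matW = 1 := by decide +kernel
theorem matA_mul_matC : matA * matC = matC3 * matA := by decide +kernel
theorem matW_mul_matA : matW * matA = matA4 * matW := by decide +kernel
theorem matC_mul_matW_cube : (matC * matW) * (matC * matW) * (matC * matW) = 1 := by decide +kernel
theorem matC_ne_one : matC ≠ 1 := by decide +kernel
-- This selects `ξ` rather than its dual: the residue powers of every eigenvalue of `matC` add up to
-- `λ`, not to its conjugate.
theorem matC_period_sum : matC + matC3 + matC4 + matC5 + matC9 = Matrix.diagonal fun _ => ⟨0, 1⟩ := by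
  decide +kernel

theorem matA_unitary : matAᴴ * gramR * matA = gramR := by decide +kernel
theorem matC_unitary : matCᴴ * gramR * matC = gramR := by decide +kernel
theorem matW_unitary : matWᴴ * gramR * matW = gramR := by decide +kernel

/-! ## Exterior squares of matrices -/

section compound

variable {R S : Type*} [CommRing R] [CommRing S]

/-- The second compound matrix of a matrix of size `5`. -/
def compound (M : Matrix (Fin 5) (Fin 5) R) : Matrix (Fin 10) (Fin 10) R :=
  Matrix.of fun p q =>
    M (pairs p).1 (pairs q).1 * M (pairs p).2 (pairs q).2
      - M (pairs p).1 (pairs q).2 * M (pairs p).2 (pairs q).1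

theorem compound_apply (M : Matrix (Fin 5) (Fin 5) R) (p q : Fin 10) :
    compound M p q = M (pairs p).1 (pairs q).1 * M (pairs p).2 (pairs q).2
      - M (pairs p).1 (pairs q).2 * M (pairs p).2 (pairs q).1 := rfl

theorem wedgeGram_eq_compound (M : Matrix (Fin 5) (Fin 5) ℂ) : wedgeGram M = compound M := rfl

theorem pairs_lt : ∀ p, (pairs p).1 < (pairs p).2 := by decide

theorem pairs_injective : Function.Injective pairs := by decide

theorem pairs_lex : ∀ p q : Fin 10, q < p →
    (pairs q).1 < (pairs p).1 ∨ (pairs q).1 = (pairs p).1 ∧ (pairs q).2 < (pairs p).2 := by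
  decide

/-- The Cauchy–Binet formula for minors of order 2. -/
theorem compound_mul (A B : Matrix (Fin 5) (Fin 5) R) :
    compound (A * B) = compound A * compound B := by
  ext p q
  simp only [compound_apply, Matrix.mul_apply]
  -- The identity holds for arbitrary row indices `i, j` and column indices `k, l`; freeing them
  -- leaves one polynomial identity instead of a hundred cases.
  generalize (pairs p).1 = i
  generalize (pairs p).2 = j
  generalize (pairs q).1 = k
  generalize (pairs q).2 = l
  simp [Fin.sum_univ_succ, pairs]
  ring

theorem compound_diagonal (d : Fin 5 → R) :
    compound (Matrix.diagonal d)
      = Matrix.diagonal fun p => d (pairs p).1 * d (pairs p).2 := by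
  ext p q
  rw [compound_apply]
  by_cases hpq : p = q
  · subst hpq
    simp [Matrix.diagonal_apply_ne _ (pairs_lt p).ne]
  · rw [Matrix.diagonal_apply_ne _ hpq]
    have h1 := pairs_lt p
    have h2 := pairs_lt q
    have h3 : ¬((pairs p).1 = (pairs q).1 ∧ (pairs p).2 = (pairs q).2) := fun h =>
      hpq (pairs_injective (Prod.ext h.1 h.2))
    have h4 : ¬((pairs p).1 = (pairs q).2 ∧ (pairs p).2 = (pairs q).1) := by
      rintro ⟨e1, e2⟩
      rw [e1, e2] at h1
      exact lt_asymm h1 h2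
    simp only [Matrix.diagonal_apply, ite_mul, zero_mul, mul_ite, mul_zero]
    grind

theorem compound_one : compound (1 : Matrix (Fin 5) (Fin 5) R) = 1 := by
  rw [← Matrix.diagonal_one, compound_diagonal, ← Matrix.diagonal_one]
  simp

theorem compound_smul (c : R) (A : Matrix (Fin 5) (Fin 5) R) :
    compound (c • A) = (c * c) • compound A := by
  ext p q
  simp only [compound_apply, Matrix.smul_apply, smul_eq_mul]
  ring

theorem compound_map (f : R →+* S) (A : Matrix (Fin 5) (Fin 5) R) :
    compound (A.map f) = (compound A).map f := by
  ext p q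
  simp [compound_apply]

theorem compound_conjTranspose [StarRing R] (A : Matrix (Fin 5) (Fin 5) R) :
    compound Aᴴ = (compound A)ᴴ := by
  ext p q
  simp only [compound_apply, Matrix.conjTranspose_apply, star_sub, star_mul']
  ring

/-- This depends on the lexicographic order of the pairs: when `q < p`, each of the two products in
the minor has a factor below the diagonal. -/
theorem compound_triangular {A : Matrix (Fin 5) (Fin 5) R} (hA : A.BlockTriangular id) :
    (compound A).BlockTriangular id := by
  intro p q hpq
  have h1 := pairs_lt p
  have h2 := pairs_lt q
  rw [compound_apply]
  rcases pairs_lex p q hpq with h | ⟨h, h'⟩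
  · rw [hA (show id (pairs q).1 < id (pairs p).1 from h),
      hA (show id (pairs q).1 < id (pairs p).2 from h.trans h1), zero_mul, mul_zero, sub_zero]
  · rw [hA (show id (pairs q).2 < id (pairs p).2 from h'),
      hA (show id (pairs q).1 < id (pairs p).2 from h.trans_lt h1), mul_zero, mul_zero, sub_zero]

/-- The second compound matrix as a homomorphism of monoids. -/
def compoundHom (R : Type*) [CommRing R] :
    Matrix (Fin 5) (Fin 5) R →* Matrix (Fin 10) (Fin 10) R where
  toFun := compound
  map_one' := compound_one
  map_mul' := compound_mul

end compound

/-! ## Positivity and unimodularity -/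

/-- Positivity is invariant under congruence. The scalar `c` clears denominators, so that the
factorization can be verified over `ℤ[λ]`. -/
theorem posDef_of_cholesky {n : ℕ} {M U : Matrix (Fin n) (Fin n) ℂ} {d : Fin n → ℂ} {c : ℝ}
    (hc : 0 < c) (h : Uᴴ * Matrix.diagonal d * U = (c : ℂ) • M) (hd : ∀ i, 0 < d i)
    (hU : IsUnit U.det) : M.PosDef := by
  have h1 : ((c : ℂ) • M).PosDef := by
    rw [← h]
    exact (Matrix.PosDef.diagonal hd).conjTranspose_mul_mul_same
      (Matrix.mulVec_injective_of_isUnit ((Matrix.isUnit_iff_isUnit_det _).2 hU))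
  have h2 : M = ((c⁻¹ : ℝ) : ℂ) • ((c : ℂ) • M) := by
    rw [smul_smul, ← Complex.ofReal_mul, inv_mul_cancel₀ hc.ne', Complex.ofReal_one, one_smul]
  rw [h2]
  exact h1.smul (by simpa using hc)

theorem cholR_det : cholR.det = 48 := by
  rw [Matrix.det_of_isUpperTriangular cholR_triangular]
  decide +kernel

/-- Each of the five diagonal entries occurs in four of the ten pairs, hence the fourth power. -/
theorem compound_cholR_det : (compound cholR).det = 48 ^ 4 := by
  rw [Matrix.det_of_isUpperTriangular (compound_triangular cholR_triangular)]
  decide +kernel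

theorem cholR_spec_compound :
    (compound cholR)ᴴ * Matrix.diagonal (fun p => cholDiag (pairs p).1 * cholDiag (pairs p).2)
      * compound cholR = (144 : QLam) • compound gramR := by
  rw [← compound_conjTranspose, ← compound_diagonal, ← compound_mul, ← compound_mul, cholR_spec,
    ← Nat.cast_smul_eq_nsmul QLam, compound_smul]
  norm_num

/-- Taking determinants in the factorization gives `c ^ n = c ^ n * det M`. -/
theorem isUnimodularHermitian_of_cholesky {n : ℕ} {M U : Matrix (Fin n) (Fin n) QLam}
    {d : Fin n → QLam} {c : ℕ} (hc : 0 < c) (h : Uᴴ * Matrix.diagonal d * U = (c : QLam) • M)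
    (hd : ∀ i, 0 < toC (d i)) (hU : U.det ≠ 0) (hdet : star U.det * (∏ i, d i) * U.det = c ^ n) :
    IsUnimodularHermitian (M.map toC) := by
  have hC : (U.map toC)ᴴ * Matrix.diagonal (fun i => toC (d i)) * U.map toC
      = ((c : ℝ) : ℂ) • M.map toC := by
    have := congrArg (fun A => A.map toC) h
    simp only [Matrix.map_mul, map_toC_conjTranspose, Matrix.diagonal_map (map_zero toC)] at this
    rw [this]
    ext i j
    simp
  refine ⟨fun i j => toC_mem _, posDef_of_cholesky (c := c) (by exact_mod_cast hc) hC hd ?_, ?_⟩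
  · rw [← RingHom.mapMatrix_apply, ← RingHom.map_det, isUnit_iff_ne_zero]
    exact (map_ne_zero_iff _ toC_injective).2 hU
  · have h1 := congrArg Matrix.det h
    rw [Matrix.det_mul, Matrix.det_mul, Matrix.det_conjTranspose, Matrix.det_diagonal, hdet,
      Matrix.det_smul, Fintype.card_fin] at h1
    have h2 := congrArg toC h1
    rw [map_mul, map_pow, map_natCast] at h2
    have hc' : (c : ℂ) ^ n ≠ 0 := pow_ne_zero _ (by exact_mod_cast hc.ne')
    rw [← RingHom.mapMatrix_apply, ← RingHom.map_det]
    exact mul_left_cancel₀ hc' (by rw [← h2, mul_one])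

theorem cholDiag_pos (i : Fin 5) : 0 < toC (cholDiag i) := by
  obtain ⟨n, hn, h⟩ : ∃ n : ℕ, 0 < n ∧ cholDiag i = n := by
    fin_cases i
    exacts [⟨4, by decide, rfl⟩, ⟨1, by decide, rfl⟩, ⟨3, by decide, rfl⟩, ⟨3, by decide, rfl⟩,
      ⟨3, by decide, rfl⟩]
  rw [h, map_natCast]
  exact_mod_cast hn

theorem isUnimodularHermitian_gram5 : IsUnimodularHermitian gram5 := by
  rw [gram5_eq]
  refine isUnimodularHermitian_of_cholesky (c := 12) (by norm_num)
    (by rw [Nat.cast_smul_eq_nsmul]; exact cholR_spec) cholDiag_pos ?_ ?_ <;> rw [cholR_det]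
  · decide +kernel
  -- `48² · 108 = 12⁵`, where `108 = 4 · 1 · 3 · 3 · 3`.
  · decide +kernel

theorem wedgeGram_gram5_eq : wedgeGram gram5 = (compound gramR).map toC := by
  rw [wedgeGram_eq_compound, gram5_eq, compound_map]

theorem isUnimodularHermitian_wedgeGram : IsUnimodularHermitian (wedgeGram gram5) := by
  rw [wedgeGram_gram5_eq]
  refine isUnimodularHermitian_of_cholesky (c := 144) (by norm_num) cholR_spec_compound
    (fun p => by rw [map_mul]; exact mul_pos (cholDiag_pos _) (cholDiag_pos _)) ?_ ?_ <;>
    rw [compound_cholR_det]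
  · decide +kernel
  -- The fourth power of the previous identity: `48⁸ · 108⁴ = 144¹⁰`.
  · decide +kernel

/-! ## The integral representation of `PSL(2, 𝔽₁₁)` -/

theorem matC3_eq : matC3 = matC ^ 3 := by rw [← matC2_mul_matC, ← matC_mul_matC, pow_succ, sq]

theorem matC4_eq : matC4 = matC ^ 4 := by
  rw [← matC2_mul_matC2, ← matC_mul_matC, ← sq matC, ← pow_add]

theorem matC5_eq : matC5 = matC ^ 5 := by rw [← matC4_mul_matC, matC4_eq, ← pow_succ]

theorem matC9_eq : matC9 = matC ^ 9 := by rw [← matC5_mul_matC4, matC4_eq, matC5_eq, ← pow_add]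

theorem matC_pow_eleven : matC ^ 11 = 1 := by
  rw [← matC9_mul_matC2, ← matC_mul_matC, matC9_eq, ← sq matC, ← pow_add]

theorem matA4_eq : matA4 = matA ^ 4 := by
  rw [← matA2_mul_matA2, ← matA_mul_matA, ← sq matA, ← pow_add]

theorem matA_pow_five : matA ^ 5 = 1 := by rw [← matA4_mul_matA, matA4_eq, ← pow_succ]

/-- `matA` as an invertible matrix. -/
def unitA : (Matrix (Fin 5) (Fin 5) QLam)ˣ := Units.ofPowEqOne matA 5 matA_pow_five (by norm_num)

/-- `matC` as an invertible matrix. -/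
def unitC : (Matrix (Fin 5) (Fin 5) QLam)ˣ := Units.ofPowEqOne matC 11 matC_pow_eleven (by norm_num)

/-- `matW` as an invertible matrix. -/
def unitW : (Matrix (Fin 5) (Fin 5) QLam)ˣ := ⟨matW, matW, matW_mul_matW, matW_mul_matW⟩

theorem relations : PSLPresentation.Relations unitA unitC unitW where
  a_pow := Units.ext matA_pow_five
  c_pow := Units.ext matC_pow_eleven
  w_sq := Units.ext matW_mul_matW
  a_c := Units.ext (by rw [Units.val_mul, Units.val_mul, Units.val_pow_eq_pow_val]
                       exact matC3_eq ▸ matA_mul_matC)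
  w_a := by
    have h : unitA⁻¹ = unitA ^ 4 := inv_eq_of_mul_eq_one_left (Units.ext (by
      rw [← pow_succ, Units.val_pow_eq_pow_val]; exact matA_pow_five))
    rw [h]
    refine Units.ext ?_
    rw [Units.val_mul, Units.val_mul, Units.val_pow_eq_pow_val]
    exact matA4_eq ▸ matW_mul_matA
  c_w := Units.ext (by
    rw [Units.val_pow_eq_pow_val, Units.val_mul, pow_succ, sq]
    exact matC_mul_matW_cube)

/-- The representation of `𝔾` by matrices over `ℤ[λ]` preserving `H'`. -/
def intRep : GG →* Matrix (Fin 5) (Fin 5) QLam := (Units.coeHom _).comp relations.hom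

theorem intRep_elemA : intRep elemA = matA := congrArg Units.val relations.hom_elemA

theorem intRep_elemC : intRep elemC = matC := congrArg Units.val relations.hom_elemC

theorem exists_intRep_eq_matW : ∃ w, intRep w = matW := 
  ⟨QuotientGroup.mk PSLPresentation.slW, congrArg Units.val relations.hom_slW⟩

/-- Isometries form a submonoid, and each value of `bruhat` is a word in the three generators. -/
theorem intRep_unitary (g : GG) : (intRep g)ᴴ * gramR * intRep g = gramR := by
  let S : Submonoid (Matrix (Fin 5) (Fin 5) QLam) :=
    { carrier := {A | Aᴴ * gramR * A = gramR}
      one_mem' := by simp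
      mul_mem' := by
        intro A B hA hB
        have : (A * B)ᴴ * gramR * (A * B) = Bᴴ * (Aᴴ * gramR * A) * B := by
          simp only [Matrix.conjTranspose_mul, Matrix.mul_assoc]
        rw [Set.mem_ofPred_eq, this, hA, hB] }
  have hA : matA ∈ S := matA_unitary
  have hC : matC ∈ S := matC_unitary
  have hW : matW ∈ S := matW_unitary
  have htor (s : ZMod 11) : (PSLPresentation.tor unitA s).val ∈ S := by
    rw [PSLPresentation.tor, Units.val_pow_eq_pow_val]; exact pow_mem hA _
  have hunip (t : ZMod 11) : (PSLPresentation.unip unitC t).val ∈ S := by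
    rw [PSLPresentation.unip, Units.val_pow_eq_pow_val]; exact pow_mem hC _
  obtain ⟨g, rfl⟩ := QuotientGroup.mk_surjective g
  show (PSLPresentation.bruhat unitA unitC unitW g).val ∈ S
  unfold PSLPresentation.bruhat
  split_ifs
  · exact mul_mem (htor _) (hunip _)
  · exact mul_mem (mul_mem (mul_mem (hunip _) hW) (htor _)) (hunip _)

theorem exists_isHermitianAut_orderOf :
    ∃ A : Matrix (Fin 5) (Fin 5) ℂ, IsHermitianAut gram5 A ∧ orderOf A = 11 := by
  refine ⟨matC.map toC, ⟨fun i j => toC_mem _, unitC.isUnit.map (RingHom.mapMatrix toC), ?_⟩, ?_⟩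
  · rw [gram5_eq, ← map_toC_conjTranspose, ← Matrix.map_mul, ← Matrix.map_mul, matC_unitary]
  · refine orderOf_eq_prime ?_ ?_
    · rw [← RingHom.mapMatrix_apply, ← map_pow, matC_pow_eleven, map_one]
    · rw [← RingHom.mapMatrix_apply, ← map_one (RingHom.mapMatrix toC)]
      exact (Matrix.map_injective toC_injective).ne matC_ne_one

/-! ## Actions on complex tori from linear actions preserving the lattice -/

namespace ComplexTorus

section action

variable {V X : Type*} [NormedAddCommGroup V] [NormedSpace ℂ V] [FiniteDimensional ℂ V]
  [AddCommGroup X] (T : ComplexTorus V X)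

/-- The endomorphism of a complex torus induced by a linear map preserving the lattice. -/
noncomputable def inducedHom (A : V →ₗ[ℂ] V) (hA : ∀ v ∈ T.lattice, A v ∈ T.lattice) : X →+ X :=
  T.proj.liftOfRightInverse (Function.surjInv T.surjective)
    (Function.rightInverse_surjInv T.surjective)
    ⟨T.proj.comp A.toAddMonoidHom, fun v hv => hA v hv⟩

theorem inducedHom_proj (A : V →ₗ[ℂ] V) (hA : ∀ v ∈ T.lattice, A v ∈ T.lattice) (v : V) :
    T.inducedHom A hA (T.proj v) = T.proj (A v) :=
  T.proj.liftOfRightInverse_comp_apply _ _ _ v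

theorem isHolomorphic_inducedHom (A : V →ₗ[ℂ] V) (hA : ∀ v ∈ T.lattice, A v ∈ T.lattice) :
    T.IsHolomorphic (T.inducedHom A hA) := fun v =>
  ⟨A.toContinuousLinearMap, A.toContinuousLinearMap.analyticAt v,
    .of_forall fun w => T.inducedHom_proj A hA w⟩

theorem hasTangentMap_inducedHom (A : V →ₗ[ℂ] V) (hA : ∀ v ∈ T.lattice, A v ∈ T.lattice) :
    T.HasTangentMap (T.inducedHom A hA) A.toContinuousLinearMap :=
  ⟨A.toContinuousLinearMap, map_zero _, A.toContinuousLinearMap.hasFDerivAt,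
    .of_forall fun w => T.inducedHom_proj A hA w⟩

variable {G : Type*} [Group G] {σ : Representation ℂ G V}
  (hσ : ∀ g, ∀ v ∈ T.lattice, σ g v ∈ T.lattice)

/-- The permutation of a complex torus induced by an element of a group acting linearly on the
tangent space and preserving the lattice. -/
noncomputable def inducedPerm (g : G) : Equiv.Perm X where
  toFun := T.inducedHom (σ g) (hσ g)
  invFun := T.inducedHom (σ g⁻¹) (hσ g⁻¹)
  left_inv x := by
    obtain ⟨v, rfl⟩ := T.surjective x
    rw [inducedHom_proj, inducedHom_proj, ← Module.End.mul_apply, ← map_mul, inv_mul_cancel,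
      map_one, Module.End.one_apply]
  right_inv x := by
    obtain ⟨v, rfl⟩ := T.surjective x
    rw [inducedHom_proj, inducedHom_proj, ← Module.End.mul_apply, ← map_mul, mul_inv_cancel,
      map_one, Module.End.one_apply]

theorem inducedPerm_proj (g : G) (v : V) : T.inducedPerm hσ g (T.proj v) = T.proj (σ g v) :=
  T.inducedHom_proj (σ g) (hσ g) v

variable {H : V →ₗ[ℂ] V →ₗ⋆[ℂ] ℂ} (hH : ∀ g v w, H (σ g v) (σ g w) = H v w)

/-- The action on a polarized complex torus induced by a linear action preserving the lattice and
the polarization. -/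
noncomputable def inducedAction : G →* T.polarizedAut H where
  toFun g := ⟨T.inducedPerm hσ g, (T.inducedHom (σ g) (hσ g)).map_add,
    T.isHolomorphic_inducedHom (σ g) (hσ g), T.isHolomorphic_inducedHom (σ g⁻¹) (hσ g⁻¹), _,
    T.hasTangentMap_inducedHom (σ g) (hσ g), hH g⟩
  map_one' := by
    refine Subtype.ext (Equiv.ext fun x => ?_)
    obtain ⟨v, rfl⟩ := T.surjective x
    exact (T.inducedPerm_proj hσ 1 v).trans (by rw [map_one]; rfl)
  map_mul' g h := by
    refine Subtype.ext (Equiv.ext fun x => ?_)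
    obtain ⟨v, rfl⟩ := T.surjective x
    show T.inducedPerm hσ (g * h) (T.proj v) = T.inducedPerm hσ g (T.inducedPerm hσ h (T.proj v))
    simp only [inducedPerm_proj, map_mul, Module.End.mul_apply]

theorem isAnalyticRepresentation_inducedAction :
    T.IsAnalyticRepresentation (T.inducedAction hσ hH) σ := fun g =>
  ⟨_, T.hasTangentMap_inducedHom (σ g) (hσ g), LinearMap.coe_toContinuousLinearMap _⟩

/-- Tangent maps are unique, so `ρ g` determines `σ g`. -/
theorem IsAnalyticRepresentation.injective {T : ComplexTorus V X} {ρ : G →* T.polarizedAut H}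
    (h : T.IsAnalyticRepresentation ρ σ) (hinj : Function.Injective σ) :
    Function.Injective ρ := by
  intro g g' hg
  obtain ⟨A, hA, hAσ⟩ := h g
  obtain ⟨A', hA', hAσ'⟩ := h g'
  rw [hg] at hA
  exact hinj (by rw [← hAσ, ← hAσ', hA.unique hA'])

end action

end ComplexTorus

/-! ## Principal polarizations of `E_λ ^ n` -/

theorem mem_lattice_ELamPow {n : ℕ} {v : Fin n → ℂ} :
    v ∈ (ELamPow n).lattice ↔ ∀ i, v i ∈ ZLam := by
  refine ⟨fun h i => ?_, fun h => funext fun i => ?_⟩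
  · exact (QuotientAddGroup.eq_zero_iff (N := ZLam.toSubring.toAddSubgroup) (v i)).1 (congrFun h i)
  · exact (QuotientAddGroup.eq_zero_iff (N := ZLam.toSubring.toAddSubgroup) (v i)).2 (h i)

theorem lam_im_pos : 0 < lam.im := by
  rw [lam_im]; positivity

theorem star_mem_ZLam {z : ℂ} (hz : z ∈ ZLam) : star z ∈ ZLam := by
  obtain ⟨a, b, rfl⟩ := exists_of_mem_ZLam hz
  rw [star_add, star_mul', star_intCast, star_intCast, star_lam]
  exact add_mem (intCast_mem _ _)
    (mul_mem (intCast_mem _ _) (sub_mem (neg_mem (one_mem _)) lam_mem))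

/-- Dividing by `Im λ` reads off the coefficient `b` of `a + b λ`. -/
theorem exists_im_eq_of_mem_ZLam {z : ℂ} (hz : z ∈ ZLam) :
    ∃ n : ℤ, (((lam.im)⁻¹ : ℂ) * z).im = n := by
  obtain ⟨a, b, rfl⟩ := exists_of_mem_ZLam hz
  refine ⟨b, ?_⟩
  rw [← Complex.ofReal_inv, Complex.im_ofReal_mul]
  have := lam_im_pos.ne'
  simp
  field_simp

/-- Self-duality of `ℤ[λ]`: for `z = a + b λ`, pairing with `1` returns `b` and pairing with `λ`
returns `-a`. -/
theorem mem_ZLam_of_im {z : ℂ} (h1 : ∃ n : ℤ, (((lam.im)⁻¹ : ℂ) * z).im = n)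
    (h2 : ∃ n : ℤ, (((lam.im)⁻¹ : ℂ) * (star lam * z)).im = n) : z ∈ ZLam := by
  obtain ⟨b, hb⟩ := h1
  obtain ⟨a, ha⟩ := h2
  have hne := lam_im_pos.ne'
  rw [← Complex.ofReal_inv, Complex.im_ofReal_mul, inv_mul_eq_iff_eq_mul₀ hne] at ha hb
  have hz : z = ((-a : ℤ) : ℂ) + b * lam := by
    apply Complex.ext
    · simp [lam_re] at ha ⊢
      rw [hb] at ha
      apply mul_left_cancel₀ hne
      linear_combination -ha
    · simp [hb, mul_comm]
  rw [hz]
  exact add_mem (intCast_mem _ _) (mul_mem (intCast_mem _ _) lam_mem)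

section polarization

variable {n : ℕ} {M : Matrix (Fin n) (Fin n) ℂ}

theorem hermitianForm_apply (v w : Fin n → ℂ) :
    hermitianForm M v w = ((lam.im)⁻¹ : ℂ) * (star w ⬝ᵥ M *ᵥ v) := rfl

theorem mulVec_mem_ZLam (hM : ∀ i j, M i j ∈ ZLam) {v : Fin n → ℂ} (hv : ∀ i, v i ∈ ZLam)
    (i : Fin n) : (M *ᵥ v) i ∈ ZLam := by
  rw [Matrix.mulVec, dotProduct]
  exact sum_mem fun j _ => mul_mem (hM i j) (hv j)

theorem isPolarization_hermitianForm (hM : ∀ i j, M i j ∈ ZLam) (hpos : M.PosDef) :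
    (ELamPow n).IsPolarization (hermitianForm M) where
  hermitian v w := by
    rw [hermitianForm_apply, hermitianForm_apply, star_mul', Matrix.star_dotProduct,
      Matrix.star_mulVec, hpos.1.eq, ← Matrix.dotProduct_mulVec]
    simp
  pos v hv := by
    have h := hpos.dotProduct_mulVec_pos hv
    rw [hermitianForm_apply, ← Complex.ofReal_inv, Complex.re_ofReal_mul]
    exact mul_pos (inv_pos.2 lam_im_pos) (Complex.pos_iff.1 h).1
  integral v hv w hw := by
    rw [mem_lattice_ELamPow] at hv hw
    exact exists_im_eq_of_mem_ZLam
      (sum_mem fun i _ => mul_mem (star_mem_ZLam (hw i)) (mulVec_mem_ZLam hM hv i))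

theorem hermitianForm_single (v : Fin n → ℂ) (i : Fin n) (z : ℂ) :
    hermitianForm M v (Pi.single i z) = ((lam.im)⁻¹ : ℂ) * (star z * (M *ᵥ v) i) := by
  rw [hermitianForm_apply, ← Pi.single_star, single_dotProduct]

/-- With determinant 1 the inverse is the adjugate, whose entries are polynomials in those of `M`.
-/
theorem inv_mem_ZLam (hM : ∀ i j, M i j ∈ ZLam) (hdet : M.det = 1) (i j : Fin n) :
    M⁻¹ i j ∈ ZLam := by
  have hN : ∃ N : Matrix (Fin n) (Fin n) ZLam, M = N.map ZLam.val :=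
    ⟨Matrix.of fun i j => ⟨M i j, hM i j⟩, rfl⟩
  obtain ⟨N, rfl⟩ := hN
  rw [Matrix.inv_def, hdet, Ring.inverse_one, one_smul]
  have := RingHom.map_adjugate ZLam.val.toRingHom N
  have h2 := congrFun (congrFun this i) j
  exact h2 ▸ ((N.adjugate i j).2 : ZLam.val (N.adjugate i j) ∈ ZLam)

/-- Testing against the lattice vectors `eᵢ` and `λ eᵢ` shows that `M v` is integral; then `M⁻¹` is
applied. -/
theorem mem_dualLattice_iff (hM : ∀ i j, M i j ∈ ZLam) (hpos : M.PosDef) (hdet : M.det = 1)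
    (v : Fin n → ℂ) :
    hermitianForm M v ∈ (ELamPow n).dualLattice ↔ v ∈ (ELamPow n).lattice := by
  refine ⟨fun h => ?_, fun hv w hw => (isPolarization_hermitianForm hM hpos).integral v hv w hw⟩
  have hu (i : Fin n) : (M *ᵥ v) i ∈ ZLam := by
    have key (z : ℂ) (hz : z ∈ ZLam) :
        ∃ m : ℤ, (((lam.im)⁻¹ : ℂ) * (star z * (M *ᵥ v) i)).im = m := by
      rw [← hermitianForm_single]
      refine h _ (mem_lattice_ELamPow.2 fun j => ?_)
      rw [Pi.single_apply]
      split_ifs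
      exacts [hz, zero_mem _]
    exact mem_ZLam_of_im (by simpa using key 1 (one_mem _)) (key lam lam_mem)
  rw [mem_lattice_ELamPow]
  have hv : v = M⁻¹ *ᵥ (M *ᵥ v) := by
    rw [Matrix.mulVec_mulVec, Matrix.nonsing_inv_mul _ (by rw [hdet]; exact isUnit_one),
      Matrix.one_mulVec]
  rw [hv]
  exact mulVec_mem_ZLam (inv_mem_ZLam hM hdet) hu

theorem hermitianForm_surjective (hdet : M.det = 1) :
    Function.Surjective (hermitianForm M) := by
  intro l
  refine ⟨M⁻¹ *ᵥ fun i => (lam.im : ℂ) * l (Pi.single i 1), ?_⟩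
  have hne : (lam.im : ℂ) ≠ 0 := by exact_mod_cast lam_im_pos.ne'
  ext w
  have hw : w = ∑ i, w i • Pi.single i (1 : ℂ) := by
    conv_lhs => rw [← Finset.univ_sum_single w]
    simp [← Pi.single_smul]
  rw [hermitianForm_apply, Matrix.mulVec_mulVec,
    Matrix.mul_nonsing_inv _ (by rw [hdet]; exact isUnit_one), Matrix.one_mulVec]
  conv_rhs => rw [hw, map_sum]
  rw [dotProduct, Finset.mul_sum]
  refine Finset.sum_congr rfl fun i _ => ?_
  rw [LinearMap.map_smulₛₗ, smul_eq_mul, Pi.star_apply, starRingEnd_apply]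
  field_simp

/-- The covering and the map to the dual torus are surjections from the same space with the same
kernel, so their targets are isomorphic. -/
theorem isPrincipalPolarization_hermitianForm (hM : IsUnimodularHermitian M) :
    (ELamPow n).IsPrincipalPolarization (hermitianForm M) := by
  obtain ⟨hint, hpos, hdet⟩ := hM
  refine ⟨isPolarization_hermitianForm hint hpos, ?_⟩
  let T := ELamPow n
  let f : (Fin n → ℂ) →+ T.Dual :=
    (QuotientAddGroup.mk' T.dualLattice).comp (hermitianForm M).toAddMonoidHom
  have hker : ∀ v, f v = 0 ↔ T.proj v = 0 := fun v =>
    (QuotientAddGroup.eq_zero_iff _).trans (mem_dualLattice_iff hint hpos hdet v)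
  have hsurj : Function.Surjective f :=
    (QuotientAddGroup.mk'_surjective _).comp (hermitianForm_surjective hdet)
  let g : (Fin n → ELam) →+ T.Dual := T.proj.liftOfRightInverse (Function.surjInv T.surjective)
    (Function.rightInverse_surjInv T.surjective) ⟨f, fun v hv => (hker v).2 hv⟩
  have hg (v) : g (T.proj v) = f v := T.proj.liftOfRightInverse_comp_apply _ _ _ v
  refine ⟨AddEquiv.ofBijective g ⟨?_, fun y => ?_⟩, hg⟩
  · rw [injective_iff_map_eq_zero]
    intro x hx
    obtain ⟨v, rfl⟩ := T.surjective x
    rwa [hg, hker] at hx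
  · obtain ⟨v, rfl⟩ := hsurj y
    exact ⟨_, hg v⟩

theorem hermitianForm_mulVec {A : Matrix (Fin n) (Fin n) ℂ} (hA : Aᴴ * M * A = M)
    (v w : Fin n → ℂ) : hermitianForm M (A *ᵥ v) (A *ᵥ w) = hermitianForm M v w := by
  rw [hermitianForm_apply, hermitianForm_apply, Matrix.star_mulVec, ← Matrix.dotProduct_mulVec,
    Matrix.mulVec_mulVec, Matrix.mulVec_mulVec, hA]

end polarization

/-! ## Gaussian periods of order `11` -/

theorem isPrimitiveRoot_zeta : IsPrimitiveRoot zeta 11 := by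
  have h := Complex.isPrimitiveRoot_exp 11 (by norm_num)
  rw [Nat.cast_ofNat] at h
  exact h

theorem zeta_pow_eleven : zeta ^ 11 = 1 := isPrimitiveRoot_zeta.pow_eq_one

theorem sum_zeta_pow : 1 + zeta + zeta ^ 2 + zeta ^ 3 + zeta ^ 4 + zeta ^ 5 + zeta ^ 6 + zeta ^ 7
    + zeta ^ 8 + zeta ^ 9 + zeta ^ 10 = 0 := by
  have h := isPrimitiveRoot_zeta.geom_sum_eq_zero (by norm_num)
  simpa [Finset.sum_range_succ] using h

theorem zeta_pow_im (k : ℕ) : (zeta ^ k).im = Real.sin (k * (2 * Real.pi / 11)) := by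
  rw [zeta, ← Complex.exp_nat_mul, ← Complex.exp_ofReal_mul_I_im]
  congr 2
  push_cast
  ring

/-- The polynomial whose value at `ζ` is the Gaussian period. -/
def period (z : ℂ) : ℂ := z + z ^ 3 + z ^ 4 + z ^ 5 + z ^ 9

theorem period_zeta_im_pos : 0 < (period zeta).im := by
  have h1 : (zeta ^ 1).im = Real.sin (2 * (Real.pi / 11)) := by
    rw [zeta_pow_im]; congr 1; push_cast; ring
  have h3 : (zeta ^ 3).im = Real.sin (5 * (Real.pi / 11)) := by
    rw [zeta_pow_im, ← Real.sin_pi_sub]; congr 1; push_cast; ring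
  have h4 : (zeta ^ 4).im = Real.sin (3 * (Real.pi / 11)) := by
    rw [zeta_pow_im, ← Real.sin_pi_sub]; congr 1; push_cast; ring
  have h5 : (zeta ^ 5).im = Real.sin (Real.pi / 11) := by
    rw [zeta_pow_im, ← Real.sin_pi_sub]; congr 1; push_cast; ring
  have h9 : (zeta ^ 9).im = -Real.sin (4 * (Real.pi / 11)) := by
    rw [zeta_pow_im, ← Real.sin_two_pi_sub]; congr 2; push_cast; ring
  have hπ := Real.pi_pos
  have p1 := Real.sin_pos_of_pos_of_lt_pi (x := Real.pi / 11) (by linarith) (by linarith)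
  have p2 := Real.sin_pos_of_pos_of_lt_pi (x := 2 * (Real.pi / 11)) (by linarith) (by linarith)
  have p3 := Real.sin_pos_of_pos_of_lt_pi (x := 3 * (Real.pi / 11)) (by linarith) (by linarith)
  -- The only negative contribution, from `ζ⁹`, is outweighed by that of `ζ³`.
  have p45 : Real.sin (4 * (Real.pi / 11)) < Real.sin (5 * (Real.pi / 11)) :=
    Real.sin_lt_sin_of_lt_of_le_pi_div_two (by linarith) (by linarith) (by linarith)
  rw [period, ← pow_one zeta]
  simp only [Complex.add_im, ← pow_mul, one_mul, h1, h3, h4, h5, h9]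
  linarith

/-- The period is a root of `x² + x + 3`, and the sign of its imaginary part decides which one. -/
theorem period_zeta : period zeta = lam := by
  have h : (period zeta - lam) * (period zeta + 1 + lam) = 0 := by
    unfold period
    -- With `η'` the sum over nonresidues, `η² = 2η + 3η'`, so `η² + η + 3 = 3(1 + η + η')`. The
    -- other coefficients reduce the exponents 12, 13, 14 and 18 modulo 11.
    linear_combination 3 * sum_zeta_pow
      + (2 * zeta + 2 * zeta ^ 2 + 2 * zeta ^ 3 + zeta ^ 7) * zeta_pow_eleven - lam_sq
  rcases mul_eq_zero.1 h with h | h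
  · exact sub_eq_zero.1 h
  · have h1 := congrArg Complex.im h
    have h2 := period_zeta_im_pos
    have h3 := lam_im_pos
    simp at h1
    linarith

theorem period_zeta_pow (k : ℕ) : period (zeta ^ k) = zeta ^ (k % 11) + zeta ^ (k * 3 % 11)
    + zeta ^ (k * 4 % 11) + zeta ^ (k * 5 % 11) + zeta ^ (k * 9 % 11) := by
  simp only [period, ← pow_mul, ← pow_eq_pow_mod _ zeta_pow_eleven]

theorem period_zeta_pow_of_residue {k : ℕ} (hk : k ∈ ({1, 3, 4, 5, 9} : Finset ℕ)) :
    period (zeta ^ k) = lam := by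
  rw [← period_zeta, period_zeta_pow, period]
  fin_cases hk <;> norm_num <;> ring

/-- A nonresidue exponent turns the sum over residues into the sum over nonresidues, and the two add
up to `-1`. -/
theorem period_zeta_pow_of_nonresidue {k : ℕ} (hk : k ∈ ({2, 6, 7, 8, 10} : Finset ℕ)) :
    period (zeta ^ k) = -1 - lam := by
  rw [← period_zeta, period_zeta_pow, period]
  fin_cases hk <;> norm_num <;> linear_combination sum_zeta_pow

theorem lam_ne : lam ≠ -1 - lam := by
  intro h
  have h1 := congrArg Complex.im h
  have h3 := lam_im_pos
  simp at h1
  linarith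

theorem residue_of_period_eq {k : ℕ} (hk : k < 11) (h : period (zeta ^ k) = lam) :
    k ∈ ({1, 3, 4, 5, 9} : Finset ℕ) := by
  by_contra hn
  by_cases h0 : k = 0
  · subst h0
    have h1 := congrArg Complex.im h
    simp [period] at h1
    exact lam_im_pos.ne h1
  · have : k ∈ ({2, 6, 7, 8, 10} : Finset ℕ) := by
      simp only [Finset.mem_insert, Finset.mem_singleton] at hn ⊢
      omega
    exact lam_ne (h.symm.trans (period_zeta_pow_of_nonresidue this))

/-! ## Irreducibility criteria -/

section irreducible

variable {G V W : Type*} [Group G] [AddCommGroup V] [Module ℂ V] [AddCommGroup W] [Module ℂ W]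

theorem Representation.isIrreducible_of_invariant [Nontrivial V] {σ : Representation ℂ G V}
    (h : ∀ N : Submodule ℂ V, (∀ g, ∀ v ∈ N, σ g v ∈ N) → N = ⊥ ∨ N = ⊤) :
    σ.IsIrreducible where
  exists_pair_ne := ⟨⊥, ⊤, fun he => bot_ne_top (congrArg Subrepresentation.toSubmodule he)⟩
  eq_bot_or_eq_top N := (h N.toSubmodule fun g _ hv => N.apply_mem_toSubmodule g hv).imp
    (fun e => Subrepresentation.toSubmodule_injective e)
    (fun e => Subrepresentation.toSubmodule_injective e)

theorem Representation.Equiv.isIrreducible {σ : Representation ℂ G V} {τ : Representation ℂ G W}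
    (e : σ.Equiv τ) (hτ : τ.IsIrreducible) : σ.IsIrreducible := by
  have : Nontrivial W := by
    obtain ⟨a, b, hab⟩ := hτ.exists_pair_ne
    by_contra hW
    rw [not_nontrivial_iff_subsingleton] at hW
    exact hab (Subrepresentation.toSubmodule_injective (Subsingleton.elim _ _))
  have : Nontrivial V := e.toLinearEquiv.toEquiv.nontrivial
  refine Representation.isIrreducible_of_invariant fun N hN => ?_
  let N' : Subrepresentation τ :=
    { toSubmodule := N.map e.toLinearEquiv.toLinearMap
      apply_mem_toSubmodule := by
        rintro g _ ⟨v, hv, rfl⟩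
        exact ⟨σ g v, hN g v hv, LinearMap.congr_fun (e.isIntertwining' g) v⟩ }
  refine (hτ.eq_bot_or_eq_top N').imp (fun h => ?_) (fun h => ?_)
  · exact (Submodule.map_eq_bot_iff (e := e.toLinearEquiv)).1
      (congrArg Subrepresentation.toSubmodule h)
  · exact (Submodule.map_eq_top_iff (e := e.toLinearEquiv)).1
      (congrArg Subrepresentation.toSubmodule h)

/-- The representation attached to a homomorphism to a monoid of matrices. -/
noncomputable def matRep {n : ℕ} (f : G →* Matrix (Fin n) (Fin n) ℂ) :
    Representation ℂ G (Fin n → ℂ) :=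
  (Matrix.toLinAlgEquiv' : Matrix (Fin n) (Fin n) ℂ ≃ₐ[ℂ] _).toAlgHom.toRingHom.toMonoidHom.comp f

theorem matRep_apply {n : ℕ} (f : G →* Matrix (Fin n) (Fin n) ℂ) (g : G) (v : Fin n → ℂ) :
    matRep f g v = f g *ᵥ v := rfl

theorem toMatrix'_matRep {n : ℕ} (f : G →* Matrix (Fin n) (Fin n) ℂ) (g : G) :
    LinearMap.toMatrix' (matRep f g) = f g := LinearMap.toMatrix'_toLin' (f g)

/-- As in Lagrange interpolation, the product of the operators `D - d j` over `j ≠ p` kills every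
coordinate except the one at `p`. -/
theorem single_mem_of_diagonal_invariant {n : ℕ} {d : Fin n → ℂ} (hd : Function.Injective d)
    {N : Submodule ℂ (Fin n → ℂ)} (hN : ∀ v ∈ N, Matrix.diagonal d *ᵥ v ∈ N)
    {v : Fin n → ℂ} (hv : v ∈ N) {p : Fin n} (hp : v p ≠ 0) : Pi.single p 1 ∈ N := by
  have key (s : Finset (Fin n)) : (fun i => (∏ j ∈ s, (d i - d j)) * v i) ∈ N := by
    induction s using Finset.induction_on with
    | empty => simpa using hv
    | insert a s ha ih =>
      have h := N.sub_mem (hN _ ih) (N.smul_mem (d a) ih)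
      convert h using 1
      ext i
      rw [Finset.prod_insert ha, Pi.sub_apply, Matrix.mulVec_diagonal, Pi.smul_apply, smul_eq_mul]
      ring
  have h := key (Finset.univ.erase p)
  set c := (∏ j ∈ Finset.univ.erase p, (d p - d j)) * v p with hc
  have hc0 : c ≠ 0 := mul_ne_zero (Finset.prod_ne_zero_iff.2 fun j hj =>
    sub_ne_zero.2 (hd.ne (Finset.ne_of_mem_erase hj).symm)) hp
  convert N.smul_mem c⁻¹ h using 1
  ext i
  by_cases hi : i = p
  · subst hi
    simp [← hc, hc0]
  · have : ∏ j ∈ Finset.univ.erase p, (d i - d j) = 0 :=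
      Finset.prod_eq_zero (Finset.mem_erase.2 ⟨hi, Finset.mem_univ i⟩) (sub_self _)
    simp [hi, this]

/-- With a simple spectrum the invariant subspaces are coordinate subspaces, so irreducibility
reduces to connectivity: no proper nonempty set of indices is closed under the nonzero entries of
the matrices. -/
theorem isIrreducible_matRep {n : ℕ} [NeZero n] {f : G →* Matrix (Fin n) (Fin n) ℂ} {c : G}
    {d : Fin n → ℂ} (hd : Function.Injective d) (hc : f c = Matrix.diagonal d)
    (hf : ∀ S : Set (Fin n), S.Nonempty → (∀ g, ∀ q ∈ S, ∀ p, f g p q ≠ 0 → p ∈ S) →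
      ∀ p, p ∈ S) : (matRep f).IsIrreducible := by
  refine Representation.isIrreducible_of_invariant fun N hN => ?_
  rw [or_iff_not_imp_left]
  intro hbot
  obtain ⟨v, hv, hv0⟩ := (Submodule.ne_bot_iff N).1 hbot
  obtain ⟨p, hp⟩ := Function.ne_iff.1 hv0
  have hsingle {v : Fin n → ℂ} (hv : v ∈ N) {p : Fin n} (hp : v p ≠ 0) : Pi.single p 1 ∈ N :=
    single_mem_of_diagonal_invariant hd (fun v hv => by rw [← hc]; exact hN c v hv) hv hp
  have hall := hf {p | Pi.single p 1 ∈ N} ⟨p, hsingle hv hp⟩ fun g q hq p hpq =>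
    hsingle (hN g _ hq) (by rwa [matRep_apply, Matrix.mulVec_single_one])
  rw [eq_top_iff]
  intro w _
  rw [← Finset.univ_sum_single w]
  refine N.sum_mem fun i _ => ?_
  have := N.smul_mem (w i) (hall i)
  rwa [← Pi.single_smul, smul_eq_mul, mul_one] at this

end irreducible

/-! ## The exterior square of a representation by matrices -/

/-- The coordinates on the exterior square. -/
noncomputable def wedgeCoord : ⋀[ℂ]^2 (Fin 5 → ℂ) →ₗ[ℂ] (Fin 10 → ℂ) :=
  exteriorPower.alternatingMapLinearEquiv
    { toFun := fun v p => v 0 (pairs p).1 * v 1 (pairs p).2 - v 0 (pairs p).2 * v 1 (pairs p).1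
      map_update_add' := by
        intro _ v i x y
        ext p
        fin_cases i <;> simp [Function.update] <;> ring
      map_update_smul' := by
        intro _ v i c x
        ext p
        fin_cases i <;> simp [Function.update] <;> ring
      map_eq_zero_of_eq' := by
        intro v i j hv hij
        have h : v 0 = v 1 := by
          fin_cases i <;> fin_cases j <;> simp_all
        ext p
        simp only [h, Pi.zero_apply]
        ring }

theorem wedgeCoord_ιMulti (v : Fin 2 → Fin 5 → ℂ) (p : Fin 10) :
    wedgeCoord (exteriorPower.ιMulti ℂ 2 v) p
      = v 0 (pairs p).1 * v 1 (pairs p).2 - v 0 (pairs p).2 * v 1 (pairs p).1 := by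
  rw [wedgeCoord, exteriorPower.alternatingMapLinearEquiv_apply_ιMulti]
  rfl

theorem wedgeCoord_surjective : Function.Surjective wedgeCoord := by
  rw [← LinearMap.range_eq_top, eq_top_iff]
  intro w _
  rw [← Finset.univ_sum_single w]
  refine Submodule.sum_mem _ fun p _ => ?_
  refine ⟨w p • exteriorPower.ιMulti ℂ 2 ![Pi.single (pairs p).1 1, Pi.single (pairs p).2 1], ?_⟩
  rw [map_smul]
  ext q
  rw [Pi.smul_apply, wedgeCoord_ιMulti, smul_eq_mul]
  -- The coordinates of `eᵢ ∧ eⱼ` form a column of the compound of the identity.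
  have h := congrFun (congrFun (compound_one (R := ℂ)) q) p
  simp only [compound_apply, Matrix.one_apply] at h
  simp only [Matrix.cons_val_zero, Matrix.cons_val_one, Pi.single_apply]
  rw [show (if q = p then w p else 0) = w p * (if q = p then 1 else 0) by simp]
  linear_combination (w p) * h

/-- The coordinates on the exterior square, as an isomorphism. -/
noncomputable def wedgeEquiv : ⋀[ℂ]^2 (Fin 5 → ℂ) ≃ₗ[ℂ] (Fin 10 → ℂ) :=
  LinearEquiv.ofBijective wedgeCoord ⟨(LinearMap.injective_iff_surjective_of_finrank_eq_finrank (by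
    rw [exteriorPower.finrank_eq, Module.finrank_fin_fun, Module.finrank_fin_fun]; rfl)).2
    wedgeCoord_surjective, wedgeCoord_surjective⟩

theorem wedgeCoord_map (A : Matrix (Fin 5) (Fin 5) ℂ) (x : ⋀[ℂ]^2 (Fin 5 → ℂ)) :
    wedgeCoord (exteriorPower.map 2 A.mulVecLin x) = compound A *ᵥ wedgeCoord x := by
  have h : wedgeCoord ∘ₗ exteriorPower.map 2 A.mulVecLin
      = (compound A).mulVecLin ∘ₗ wedgeCoord := by
    refine exteriorPower.linearMap_ext (AlternatingMap.ext fun v => funext fun p => ?_)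
    simp only [LinearMap.compAlternatingMap_apply, LinearMap.comp_apply,
      exteriorPower.map_apply_ιMulti, wedgeCoord_ιMulti, Matrix.mulVecLin_apply, Matrix.mulVec,
      dotProduct, compound_apply, Function.comp_apply]
    generalize (pairs p).1 = i
    generalize (pairs p).2 = j
    simp [Fin.sum_univ_succ, pairs]
    ring
  exact LinearMap.congr_fun h x

/-- The exterior square of a representation by matrices is given by compound matrices. -/
noncomputable def wedgeRepEquiv {G : Type*} [Group G] (f : G →* Matrix (Fin 5) (Fin 5) ℂ) :
    (matRep ((compoundHom ℂ).comp f)).Equiv (wedgeRep (matRep f)) :=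
  Representation.Equiv.mk wedgeEquiv.symm fun g => by
    refine LinearMap.ext fun v => ?_
    apply wedgeEquiv.injective
    obtain ⟨x, rfl⟩ := wedgeEquiv.surjective v
    simp only [LinearMap.comp_apply, LinearEquiv.coe_coe, LinearEquiv.apply_symm_apply,
      LinearEquiv.symm_apply_apply]
    exact (wedgeCoord_map (f g) x).symm

/-! ## The representation `ξ` -/

/-- The integral representation of `𝔾`, with values in complex matrices. -/
noncomputable def cRep : GG →* Matrix (Fin 5) (Fin 5) ℂ :=
  (RingHom.mapMatrix toC : Matrix (Fin 5) (Fin 5) QLam →+* _).toMonoidHom.comp intRep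

theorem cRep_apply (g : GG) : cRep g = (intRep g).map toC := rfl

theorem cRep_elemC_pow : cRep elemC ^ 11 = 1 := by
  rw [cRep_apply, intRep_elemC, ← RingHom.mapMatrix_apply, ← map_pow, matC_pow_eleven, map_one]

theorem cRep_elemA_mul_elemC : cRep elemA * cRep elemC = cRep elemC ^ 3 * cRep elemA := by
  simp only [cRep_apply, intRep_elemC, intRep_elemA, ← RingHom.mapMatrix_apply, ← map_pow,
    ← map_mul]
  rw [matA_mul_matC, matC3_eq]

theorem cRep_elemA_pow : cRep elemA ^ 5 = 1 := by
  rw [cRep_apply, intRep_elemA, ← RingHom.mapMatrix_apply, ← map_pow, matA_pow_five, map_one]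

theorem cRep_period_sum : cRep elemC + cRep elemC ^ 3 + cRep elemC ^ 4 + cRep elemC ^ 5
    + cRep elemC ^ 9 = lam • (1 : Matrix (Fin 5) (Fin 5) ℂ) := by
  have h := congrArg (RingHom.mapMatrix toC) matC_period_sum
  rw [matC3_eq, matC4_eq, matC5_eq, matC9_eq] at h
  simp only [map_add, map_pow] at h
  rw [cRep_apply, intRep_elemC, ← RingHom.mapMatrix_apply, h, RingHom.mapMatrix_apply,
    Matrix.diagonal_map (map_zero toC), Matrix.smul_one_eq_diagonal]
  simp [toC_apply]

theorem pow_mulVec_of_eigenvector {n : ℕ} {A : Matrix (Fin n) (Fin n) ℂ} {v : Fin n → ℂ} {μ : ℂ}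
    (h : A *ᵥ v = μ • v) (k : ℕ) : (A ^ k) *ᵥ v = μ ^ k • v := by
  induction k with
  | zero => simp
  | succ k ih => rw [pow_succ, ← Matrix.mulVec_mulVec, h, Matrix.mulVec_smul, ih, smul_smul,
      ← pow_succ']

/-- From `a c = c³ a` and `3 · 4 ≡ 1` modulo 11 one gets `c a = a c⁴`. -/
theorem cRep_elemC_mulVec_elemA {v : Fin 5 → ℂ} {μ : ℂ} (h : cRep elemC *ᵥ v = μ • v) :
    cRep elemC *ᵥ (cRep elemA *ᵥ v) = μ ^ 4 • (cRep elemA *ᵥ v) := by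
  have h1 : cRep elemC * cRep elemA = cRep elemA * cRep elemC ^ 4 := by
    have hc (k : ℕ) : cRep elemA * cRep elemC ^ k = cRep elemC ^ (3 * k) * cRep elemA := by
      induction k with
      | zero => simp
      | succ k ih => rw [pow_succ, ← mul_assoc, ih, mul_assoc, cRep_elemA_mul_elemC, ← mul_assoc,
          ← pow_add]; rfl
    rw [hc, show 3 * 4 = 11 + 1 from rfl, pow_succ, cRep_elemC_pow, one_mul]
  rw [Matrix.mulVec_mulVec, h1, ← Matrix.mulVec_mulVec, pow_mulVec_of_eigenvector h,
    Matrix.mulVec_smul]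

theorem cRep_elemC_mulVec_elemA_pow {v : Fin 5 → ℂ} {μ : ℂ} (h : cRep elemC *ᵥ v = μ • v) (k : ℕ) :
    cRep elemC *ᵥ (cRep elemA ^ k *ᵥ v) = μ ^ 4 ^ k • (cRep elemA ^ k *ᵥ v) := by
  induction k with
  | zero => simpa using h
  | succ k ih =>
    rw [pow_succ', ← Matrix.mulVec_mulVec, cRep_elemC_mulVec_elemA ih, ← pow_mul, ← pow_succ]

theorem cRep_elemA_pow_mulVec_ne_zero {v : Fin 5 → ℂ} (hv : v ≠ 0) (k : ℕ) :
    cRep elemA ^ k *ᵥ v ≠ 0 := by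
  rw [← map_pow]
  intro h
  apply hv
  have := congrArg (cRep (elemA ^ k)⁻¹ *ᵥ ·) h
  simpa [← map_mul, -map_pow, -map_inv] using this

/-- Any eigenvalue is some `ζ ^ k`, and the period identity makes `k` a residue. Since 4 generates
the group of residues, a power of `a` moves the eigenvector to the eigenvalue `ζ`. -/
theorem exists_zeta_eigenvector : ∃ v : Fin 5 → ℂ, v ≠ 0 ∧ cRep elemC *ᵥ v = zeta • v := by
  obtain ⟨μ, hμ⟩ := Module.End.exists_eigenvalue (Matrix.toLin' (cRep elemC))
  obtain ⟨v, hv⟩ := hμ.exists_hasEigenvector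
  have hv0 := hv.2
  have hμv : cRep elemC *ᵥ v = μ • v := hv.apply_eq_smul
  have hpow := pow_mulVec_of_eigenvector hμv
  have hμ11 : μ ^ 11 = 1 := by
    have h := hpow 11
    rw [cRep_elemC_pow, Matrix.one_mulVec] at h
    exact smul_left_injective ℂ hv0 (by simpa using h.symm)
  obtain ⟨k, hk, rfl⟩ := isPrimitiveRoot_zeta.eq_pow_of_pow_eq_one hμ11
  have hper : period (zeta ^ k) = lam := by
    have h := congrArg (· *ᵥ v) cRep_period_sum
    simp only [Matrix.add_mulVec, hpow, hμv, Matrix.smul_mulVec, Matrix.one_mulVec,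
      ← add_smul] at h
    exact smul_left_injective ℂ hv0 h
  obtain ⟨m, hm⟩ : ∃ m, k * 4 ^ m % 11 = 1 := by
    have := residue_of_period_eq hk hper
    fin_cases this
    exacts [⟨0, rfl⟩, ⟨1, rfl⟩, ⟨4, rfl⟩, ⟨3, rfl⟩, ⟨2, rfl⟩]
  refine ⟨_, cRep_elemA_pow_mulVec_ne_zero hv0 m, ?_⟩
  rw [cRep_elemC_mulVec_elemA_pow hμv, ← pow_mul, pow_eq_pow_mod _ zeta_pow_eleven, hm, pow_one]

/-- The exponents of `ζ` in the eigenvalues of the standard transvection. -/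
def residues : Fin 5 → ℕ := ![1, 4, 5, 9, 3]

/-- The matrix by which `diag(5, 9)` acts in the representation `ξ`. -/
def cyclicMat : Matrix (Fin 5) (Fin 5) ℂ :=
  !![0, 0, 0, 0, 1;
     1, 0, 0, 0, 0;
     0, 1, 0, 0, 0;
     0, 0, 1, 0, 0;
     0, 0, 0, 1, 0]

theorem injective_zeta_pow_residues : Function.Injective fun i => zeta ^ residues i := by
  intro i j hij
  have h1 : ∀ i, residues i < 11 := by decide
  have h2 : Function.Injective residues := by decide
  exact h2 (isPrimitiveRoot_zeta.pow_inj (h1 i) (h1 j) hij)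

/-- The columns are `v, a v, …, a⁴ v` for a `ζ`-eigenvector `v` of `c`. Their eigenvalues `ζ ^ (4 ^
j)` are distinct, and `a⁵ = 1` closes the cycle. -/
theorem exists_eigenbasis : ∃ P : Matrix (Fin 5) (Fin 5) ℂ, IsUnit P ∧
    cRep elemA * P = P * cyclicMat ∧
    cRep elemC * P = P * Matrix.diagonal fun i => zeta ^ residues i := by
  obtain ⟨v, hv0, hv⟩ := exists_zeta_eigenvector
  have hC (j : Fin 5) : cRep elemC *ᵥ (cRep elemA ^ (j : ℕ) *ᵥ v)
      = zeta ^ residues j • (cRep elemA ^ (j : ℕ) *ᵥ v) := by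
    rw [cRep_elemC_mulVec_elemA_pow hv, pow_eq_pow_mod _ zeta_pow_eleven]
    congr 2
    revert j; decide
  refine ⟨Matrix.of fun i j => (cRep elemA ^ (j : ℕ) *ᵥ v) i, ?_, ?_, ?_⟩
  · rw [← Matrix.linearIndependent_cols_iff_isUnit]
    refine Module.End.eigenvectors_linearIndependent' (Matrix.toLin' (cRep elemC)) _
      injective_zeta_pow_residues _
      fun j => ⟨Module.End.mem_eigenspace_iff.2 (hC j), cRep_elemA_pow_mulVec_ne_zero hv0 j⟩
  · have key (i j : Fin 5) : (cRep elemA * Matrix.of fun i j : Fin 5 =>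
        (cRep elemA ^ (j : ℕ) *ᵥ v) i) i j = (cRep elemA ^ ((j : ℕ) + 1) *ᵥ v) i := by
      rw [pow_succ', ← Matrix.mulVec_mulVec]
      rfl
    ext i j
    rw [key]
    fin_cases j <;>
      simp [cyclicMat, Matrix.mul_apply, Fin.sum_univ_succ, cRep_elemA_pow]
  · ext i j
    rw [Matrix.mul_diagonal, mul_comm]
    exact congrFun (hC j) i

/-- Conjugation by an invertible matrix. -/
noncomputable def conjRingHom {n : ℕ} (P : (Matrix (Fin n) (Fin n) ℂ)ˣ) :
    Matrix (Fin n) (Fin n) ℂ →+* Matrix (Fin n) (Fin n) ℂ where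
  toFun A := (P⁻¹ : (Matrix (Fin n) (Fin n) ℂ)ˣ) * A * P
  map_one' := by simp
  map_mul' A B := by simp only [mul_assoc, Units.mul_inv_cancel_left]
  map_zero' := by simp
  map_add' A B := by simp only [mul_add, add_mul]

theorem conjRingHom_injective {n : ℕ} (P : (Matrix (Fin n) (Fin n) ℂ)ˣ) :
    Function.Injective (conjRingHom P) := fun A B h => by
  have h' : (P⁻¹ : (Matrix (Fin n) (Fin n) ℂ)ˣ) * A * P
    = (P⁻¹ : (Matrix (Fin n) (Fin n) ℂ)ˣ) * B * P := h
  rwa [Units.mul_left_inj, Units.mul_right_inj] at h'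

theorem conjRingHom_eq_of_mul_eq {n : ℕ} {P : (Matrix (Fin n) (Fin n) ℂ)ˣ}
    {A B : Matrix (Fin n) (Fin n) ℂ} (h : A * P = P * B) : conjRingHom P A = B := by
  show (P⁻¹ : (Matrix (Fin n) (Fin n) ℂ)ˣ) * A * P = B
  rw [mul_assoc, h, Units.inv_mul_cancel_left]

theorem conjRingHom_diagonal_const {n : ℕ} (P : (Matrix (Fin n) (Fin n) ℂ)ˣ) (c : ℂ) :
    conjRingHom P (Matrix.diagonal fun _ => c) = Matrix.diagonal fun _ => c := by
  refine conjRingHom_eq_of_mul_eq ?_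
  rw [← Matrix.smul_one_eq_diagonal, smul_mul_assoc, mul_smul_comm, one_mul, mul_one]

/-- A homomorphism to a monoid of matrices, in another basis. -/
noncomputable def conjHom {G : Type*} [Group G] {n : ℕ} (f : G →* Matrix (Fin n) (Fin n) ℂ)
    (P : (Matrix (Fin n) (Fin n) ℂ)ˣ) : G →* Matrix (Fin n) (Fin n) ℂ :=
  (conjRingHom P).toMonoidHom.comp f

/-- Representations by conjugate matrices are isomorphic. -/
noncomputable def matRepConjEquiv {G : Type*} [Group G] {n : ℕ}
    (f : G →* Matrix (Fin n) (Fin n) ℂ) (P : (Matrix (Fin n) (Fin n) ℂ)ˣ) :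
    (matRep f).Equiv (matRep (conjHom f P)) :=
  Representation.Equiv.mk
    (LinearEquiv.ofLinearMap (Matrix.mulVecLin (P⁻¹ : (Matrix (Fin n) (Fin n) ℂ)ˣ))
      (Matrix.mulVecLin (P : Matrix (Fin n) (Fin n) ℂ))
      (by rw [← Matrix.mulVecLin_mul, Units.inv_mul, Matrix.mulVecLin_one])
      (by rw [← Matrix.mulVecLin_mul, Units.mul_inv, Matrix.mulVecLin_one]))
    fun g => by
      refine LinearMap.ext fun v => ?_
      show _ *ᵥ (f g *ᵥ v) = (_ * f g * _) *ᵥ (_ *ᵥ v)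
      rw [Matrix.mulVec_mulVec, Matrix.mulVec_mulVec, mul_assoc, Units.mul_inv, mul_one]

theorem compoundHom_conjHom {G : Type*} [Group G] (f : G →* Matrix (Fin 5) (Fin 5) ℂ)
    (P : (Matrix (Fin 5) (Fin 5) ℂ)ˣ) :
    (compoundHom ℂ).comp (conjHom f P)
      = conjHom ((compoundHom ℂ).comp f) (Units.map (compoundHom ℂ) P) := by
  ext g : 1
  show compoundHom ℂ (_ * f g * _) = _
  rw [map_mul, map_mul]
  rfl

/-- The eigenvalues of the standard transvection in the exterior square of `ξ`, as powers of
`ζ`. -/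
def wedgeResidues : Fin 10 → ℕ := ![5, 6, 10, 4, 9, 2, 7, 3, 8, 1]

/-- Modulo 11, the sums of two distinct residues run exactly once through the ten nonzero classes.
-/
theorem compound_diagonal_zeta : compound (Matrix.diagonal fun i => zeta ^ residues i)
    = Matrix.diagonal fun p => zeta ^ wedgeResidues p := by
  rw [compound_diagonal]
  congr 1
  ext p
  have h : ∀ p, (residues (pairs p).1 + residues (pairs p).2) % 11 = wedgeResidues p := by decide
  rw [← pow_add, pow_eq_pow_mod _ zeta_pow_eleven, h]

/-- The operator acting by the Gaussian periods on the exterior square. -/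
def periodMat : Matrix (Fin 10) (Fin 10) QLam :=
  compound matC + compound matC3 + compound matC4 + compound matC5 + compound matC9

/-- `periodMat` acts by `λ` on the residue eigenvectors and by `-1 - λ` on the others, so the outer
factors isolate one block of `compound matW`, from nonresidues to residues. This detects the block
over `ℤ[λ]`, with no knowledge of the eigenbasis; `periodMat_mix'` is the opposite block. -/
theorem periodMat_mix :
    (periodMat - Matrix.diagonal fun _ => ⟨-1, -1⟩) * compound matW
      * (periodMat - Matrix.diagonal fun _ => ⟨0, 1⟩) ≠ 0 := by decide +kernel

theorem periodMat_mix' :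
    (periodMat - Matrix.diagonal fun _ => ⟨0, 1⟩) * compound matW
      * (periodMat - Matrix.diagonal fun _ => ⟨-1, -1⟩) ≠ 0 := by decide +kernel

theorem compound_matC_ne_one : compound matC ≠ 1 := by decide +kernel

/-! ## Irreducibility of `ξ` and of its exterior square -/

section eigenbasis

variable {P : (Matrix (Fin 5) (Fin 5) ℂ)ˣ}

theorem isIrreducible_of_eigenbasis (hA : conjHom cRep P elemA = cyclicMat)
    (hC : conjHom cRep P elemC = Matrix.diagonal fun i => zeta ^ residues i) :
    (matRep (conjHom cRep P)).IsIrreducible := by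
  refine isIrreducible_matRep injective_zeta_pow_residues hC fun S ⟨q, hq⟩ hS => ?_
  have hnext (i : Fin 5) (hi : i ∈ S) : i + 1 ∈ S := by
    refine hS elemA i hi _ ?_
    rw [hA]
    fin_cases i <;> simp [cyclicMat]
  have hcycle : ∀ p q : Fin 5, p = q ∨ p = q + 1 ∨ p = q + 1 + 1 ∨ p = q + 1 + 1 + 1 ∨
      p = q + 1 + 1 + 1 + 1 := by decide
  intro p
  rcases hcycle p q with rfl | rfl | rfl | rfl | rfl
  all_goals repeat' apply hnext
  all_goals exact hq

/-- The permutation of the indices `i < j` induced by the cyclic permutation. -/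
def nextPair : Fin 10 → Fin 10 := ![4, 5, 6, 0, 7, 8, 1, 9, 2, 3]

theorem conj_periodMat (hC : conjHom cRep P elemC = Matrix.diagonal fun i => zeta ^ residues i) :
    conjRingHom (Units.map (compoundHom ℂ) P) (periodMat.map toC)
      = Matrix.diagonal fun p => period (zeta ^ wedgeResidues p) := by
  have h1 : periodMat.map toC = compoundHom ℂ (cRep elemC) + compoundHom ℂ (cRep elemC) ^ 3
      + compoundHom ℂ (cRep elemC) ^ 4 + compoundHom ℂ (cRep elemC) ^ 5
      + compoundHom ℂ (cRep elemC) ^ 9 := by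
    have h2 (k : ℕ) : compoundHom ℂ (cRep elemC) ^ k
        = RingHom.mapMatrix toC (compound (matC ^ k)) := by
      rw [← map_pow, cRep_apply, intRep_elemC, ← RingHom.mapMatrix_apply, ← map_pow]
      exact compound_map toC (matC ^ k)
    rw [h2, h2, h2, h2, ← pow_one (compoundHom ℂ (cRep elemC)), h2, periodMat, matC3_eq, matC4_eq,
      matC5_eq, matC9_eq, pow_one, ← RingHom.mapMatrix_apply]
    simp only [map_add]
  have h3 : conjRingHom (Units.map (compoundHom ℂ) P) (compoundHom ℂ (cRep elemC))
      = Matrix.diagonal fun p => zeta ^ wedgeResidues p := by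
    rw [← compound_diagonal_zeta, ← hC]
    exact (DFunLike.congr_fun (compoundHom_conjHom cRep P) elemC).symm
  rw [h1]
  simp only [map_add, map_pow, h3, Matrix.diagonal_pow, Matrix.diagonal_add]
  rfl

/-- In the eigenbasis the triple product has entries `(y p - u) W p q (y q - v)`; a nonzero one
gives the indices. -/
theorem exists_mix {D : Matrix (Fin 10) (Fin 10) QLam} {y : Fin 10 → ℂ}
    (hD : conjRingHom (Units.map (compoundHom ℂ) P) (D.map toC) = Matrix.diagonal y)
    (u v : QLam) (h : (D - Matrix.diagonal fun _ => u) * compound matW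
      * (D - Matrix.diagonal fun _ => v) ≠ 0) :
    ∃ g p q, ((compoundHom ℂ).comp (conjHom cRep P)) g p q ≠ 0 ∧ y p ≠ toC u ∧ y q ≠ toC v := by
  obtain ⟨w, hw⟩ := exists_intRep_eq_matW
  have h1 := (map_ne_zero_iff _ (conjRingHom_injective (Units.map (compoundHom ℂ) P))).2
    ((map_ne_zero_iff (RingHom.mapMatrix toC) (Matrix.map_injective toC_injective)).2 h)
  have h2 : conjRingHom (Units.map (compoundHom ℂ) P) ((compound matW).map toC)
      = (compoundHom ℂ).comp (conjHom cRep P) w := by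
    rw [compoundHom_conjHom, ← compound_map, ← hw]
    rfl
  simp only [map_mul, map_sub, RingHom.mapMatrix_apply, hD, h2,
    Matrix.diagonal_map (map_zero toC), conjRingHom_diagonal_const] at h1
  rw [Matrix.diagonal_sub, Matrix.diagonal_sub] at h1
  obtain ⟨p, q, hpq⟩ : ∃ p q, (Matrix.diagonal (fun i => y i - toC u)
      * (compoundHom ℂ).comp (conjHom cRep P) w * Matrix.diagonal fun i => y i - toC v) p q ≠ 0 := by
    by_contra! hne
    exact h1 (Matrix.ext hne)
  rw [Matrix.mul_diagonal, Matrix.diagonal_mul] at hpq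
  refine ⟨w, p, q, fun h0 => hpq ?_, fun h0 => hpq ?_, fun h0 => hpq ?_⟩ <;> simp [h0]

theorem isIrreducible_compound_of_eigenbasis (hA : conjHom cRep P elemA = cyclicMat)
    (hC : conjHom cRep P elemC = Matrix.diagonal fun i => zeta ^ residues i) :
    (matRep ((compoundHom ℂ).comp (conjHom cRep P))).IsIrreducible := by
  have hinj : Function.Injective fun p => zeta ^ wedgeResidues p := by
    intro i j hij
    have h1 : ∀ i, wedgeResidues i < 11 := by decide
    have h2 : Function.Injective wedgeResidues := by decide
    exact h2 (isPrimitiveRoot_zeta.pow_inj (h1 i) (h1 j) hij)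
  refine isIrreducible_matRep (c := elemC) hinj ?_ fun S hne hS => ?_
  · rw [← compound_diagonal_zeta, ← hC]
    rfl
  have hnext (i : Fin 10) (hi : i ∈ S) : nextPair i ∈ S := by
    refine hS elemA i hi _ ?_
    rw [MonoidHom.comp_apply, hA]
    show compound cyclicMat _ _ ≠ 0
    fin_cases i <;> simp [compound_apply, cyclicMat, nextPair, pairs]
  -- These five indices are the pairs whose eigenvalue exponent is a quadratic residue; they form
  -- one of the two orbits of `nextPair`.
  have horbit : ∀ p q, (p ∈ ({0, 3, 4, 7, 9} : Finset (Fin 10)) ↔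
      q ∈ ({0, 3, 4, 7, 9} : Finset (Fin 10))) →
      p = q ∨ p = nextPair q ∨ p = nextPair (nextPair q) ∨ p = nextPair (nextPair (nextPair q)) ∨
        p = nextPair (nextPair (nextPair (nextPair q))) := by decide
  have hmem (p q : Fin 10) (hpq : p ∈ ({0, 3, 4, 7, 9} : Finset (Fin 10)) ↔
      q ∈ ({0, 3, 4, 7, 9} : Finset (Fin 10))) (hq : q ∈ S) : p ∈ S := by
    rcases horbit p q hpq with rfl | rfl | rfl | rfl | rfl
    all_goals repeat' apply hnext
    all_goals exact hq
  have hres (p : Fin 10) : (p ∈ ({0, 3, 4, 7, 9} : Finset (Fin 10)) ∧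
      period (zeta ^ wedgeResidues p) = lam) ∨ (p ∉ ({0, 3, 4, 7, 9} : Finset (Fin 10)) ∧
      period (zeta ^ wedgeResidues p) = -1 - lam) := by
    by_cases hp : p ∈ ({0, 3, 4, 7, 9} : Finset (Fin 10))
    · exact .inl ⟨hp, period_zeta_pow_of_residue (by revert p; decide)⟩
    · exact .inr ⟨hp, period_zeta_pow_of_nonresidue (by revert p; decide)⟩
  have e1 : toC ⟨-1, -1⟩ = -1 - lam := by simp [toC_apply]; ring
  have e2 : toC ⟨0, 1⟩ = lam := by simp [toC_apply]
  obtain ⟨g, p, q, hpq, hp, hq⟩ := exists_mix (conj_periodMat hC) _ _ periodMat_mix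
  obtain ⟨g', p', q', hpq', hp', hq'⟩ := exists_mix (conj_periodMat hC) _ _ periodMat_mix'
  rw [e1] at hp hq'
  rw [e2] at hq hp'
  have mp := (hres p).resolve_right fun h => hp h.2
  have mq := (hres q).resolve_left fun h => hq h.2
  have mp' := (hres p').resolve_left fun h => hp' h.2
  have mq' := (hres q').resolve_right fun h => hq' h.2
  -- Whichever orbit `S` meets, one of the two links carries it into the other.
  have hboth : p ∈ S ∧ p' ∈ S := by
    obtain ⟨r, hr⟩ := hne
    rcases hres r with hr' | hr'
    · exact ⟨hmem p r (iff_of_true mp.1 hr'.1) hr,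
        hS g' q' (hmem q' r (iff_of_true mq'.1 hr'.1) hr) p' hpq'⟩
    · exact ⟨hS g q (hmem q r (iff_of_false mq.1 hr'.1) hr) p hpq,
        hmem p' r (iff_of_false mp'.1 hr'.1) hr⟩
  intro r
  rcases hres r with hr | hr
  · exact hmem r p (iff_of_true hr.1 mp.1) hboth.1
  · exact hmem r p' (iff_of_false hr.1 mp'.1) hboth.2

theorem isXi_of_eigenbasis (hA : conjHom cRep P elemA = cyclicMat)
    (hC : conjHom cRep P elemC = Matrix.diagonal fun i => zeta ^ residues i) :
    IsXi (matRep (conjHom cRep P)) := by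
  refine ⟨isIrreducible_of_eigenbasis hA hC, ?_, ?_⟩
  · rw [toMatrix'_matRep, hA, cyclicMat]
  · rw [toMatrix'_matRep, hC]
    congr 1
    ext i
    fin_cases i <;> simp [residues]

end eigenbasis

/-! ## The action on `E_λ ^ 10` -/

/-- The linear representation of `𝔾` on the tangent space of `E_λ ^ 10`. -/
noncomputable def wedgeMatRep : GG →* Matrix (Fin 10) (Fin 10) ℂ := (compoundHom ℂ).comp cRep

theorem wedgeMatRep_apply (g : GG) : wedgeMatRep g = (compound (intRep g)).map toC :=
  compound_map toC (intRep g)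

theorem wedgeMatRep_mem (g : GG) (i j : Fin 10) : wedgeMatRep g i j ∈ ZLam := by
  rw [wedgeMatRep_apply]
  exact toC_mem _

theorem wedgeMatRep_unitary (g : GG) :
    (wedgeMatRep g)ᴴ * wedgeGram gram5 * wedgeMatRep g = wedgeGram gram5 := by
  rw [wedgeGram_gram5_eq, wedgeMatRep_apply, ← map_toC_conjTranspose, ← Matrix.map_mul,
    ← Matrix.map_mul, ← compound_conjTranspose, ← compound_mul, ← compound_mul, intRep_unitary]

theorem isSimpleGroup_GG : IsSimpleGroup GG :=
  Matrix.ProjectiveSpecialLinearGroup.rank_two_simple (by simp)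

/-- The group is simple, so one element acting nontrivially suffices. -/
theorem matRep_wedgeMatRep_injective : Function.Injective (matRep wedgeMatRep) := by
  have := isSimpleGroup_GG
  rw [← MonoidHom.ker_eq_bot_iff]
  refine (MonoidHom.normal_ker (matRep wedgeMatRep)).eq_bot_or_eq_top.resolve_right fun h => ?_
  have hC : elemC ∈ MonoidHom.ker (matRep wedgeMatRep) := h ▸ Subgroup.mem_top _
  have h1 := congrArg LinearMap.toMatrix' (MonoidHom.mem_ker.1 hC)
  rw [toMatrix'_matRep, wedgeMatRep_apply, intRep_elemC, LinearMap.toMatrix'_one,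
    ← RingHom.mapMatrix_apply, ← map_one (RingHom.mapMatrix toC)] at h1
  exact compound_matC_ne_one (Matrix.map_injective toC_injective h1)

theorem mainTheorem9 :
    -- the Hermitian form on `ℤ[λ] ^ 5` and its automorphism of order `11`
    IsUnimodularHermitian gram5 ∧
    (∃ A : Matrix (Fin 5) (Fin 5) ℂ, IsHermitianAut gram5 A ∧ orderOf A = 11) ∧
    -- the induced form on `⋀² ℤ[λ] ^ 5` defines a principal polarization of `E_λ ^ 10`
    IsUnimodularHermitian (wedgeGram gram5) ∧
    (ELamPow 10).IsPrincipalPolarization (hermitianForm (wedgeGram gram5)) ∧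
    -- the faithful action of `𝔾` and its analytic representation
    ∃ ρ : GG →* (ELamPow 10).polarizedAut (hermitianForm (wedgeGram gram5)),
      Function.Injective ρ ∧
      ∃ σ : Representation ℂ GG (Fin 10 → ℂ),
        (ELamPow 10).IsAnalyticRepresentation ρ σ ∧
        σ.IsIrreducible ∧
        ∃ ξ : Representation ℂ GG (Fin 5 → ℂ),
          IsXi ξ ∧ Nonempty (σ.Equiv (wedgeRep ξ)) := by
  refine ⟨isUnimodularHermitian_gram5, exists_isHermitianAut_orderOf,
    isUnimodularHermitian_wedgeGram,
    isPrincipalPolarization_hermitianForm isUnimodularHermitian_wedgeGram, ?_⟩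
  have hlat (g : GG) (v) (hv : v ∈ (ELamPow 10).lattice) :
      matRep wedgeMatRep g v ∈ (ELamPow 10).lattice :=
    mem_lattice_ELamPow.2 (mulVec_mem_ZLam (wedgeMatRep_mem g) (mem_lattice_ELamPow.1 hv))
  have hrep := (ELamPow 10).isAnalyticRepresentation_inducedAction hlat
    fun g => hermitianForm_mulVec (wedgeMatRep_unitary g)
  obtain ⟨_, ⟨P, rfl⟩, hA, hC⟩ := exists_eigenbasis
  replace hA : conjHom cRep P elemA = cyclicMat := conjRingHom_eq_of_mul_eq hA
  replace hC : conjHom cRep P elemC = Matrix.diagonal fun i => zeta ^ residues i :=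
    conjRingHom_eq_of_mul_eq hC
  -- The action preserves the lattice in the integral basis but is recognized in the eigenbasis; the
  -- compound of `P` passes from one to the other.
  have e : (matRep wedgeMatRep).Equiv (matRep ((compoundHom ℂ).comp (conjHom cRep P))) :=
    compoundHom_conjHom cRep P ▸ matRepConjEquiv wedgeMatRep (Units.map (compoundHom ℂ) P)
  exact ⟨_, hrep.injective matRep_wedgeMatRep_injective, _, hrep,
    e.isIrreducible (isIrreducible_compound_of_eigenbasis hA hC), _, isXi_of_eigenbasis hA hC,
    ⟨e.trans (wedgeRepEquiv _)⟩⟩
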